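/- Let $\ell\ge 2$ and let $\Phi$ be a (reduced, crystallographic) root system of type $B_\ell$ spanning a Euclidean space $E$, with simple roots $\alpha_1,\dots,\alpha_\ell$ in the standard numbering ($\alpha_\ell$ is the short simple root, at the end of the chain, and $\alpha_1$ is at the other end), highest root $\tilde\alpha$ and Weyl group $W$. Let $Z=\{x\in E : (\alpha,x)\in\mathbb Z \text{ for all } \alpha\in\Phi\}$ be the coweight lattice. For a positive integer $q$ the group $W$ acts on $$M(\Phi;q)=\{\,x+qZ\in Z/qZ : (\beta,x)\not\equiv 0 \ (\mathrm{mod}\ q)\text{ for all }\beta\in\Phi\,\},$$ and $\chi_{\Phi,q}(w)$ denotes the permutation character of this action, i.e. the number of points of $M(\Phi;q)$ fixed by $w$. Let $A_\circ=\{x\in E : (\alpha_i,x)>0 \text{ for all } i,\ (\tilde\alpha,x)<1\}$ be the fundamental alcove and $P^\diamond=\{x\in E : 0<(\alpha_i,x)\le 1 \text{ for all } i\}$. Then $W$ acts on $P^\diamond$ by sending $x$ to the unique point of $P^\diamond$ congruent to $w(x)$ modulo $Z$; let $W_{A_\circ}\subseteq W$ be the stabilizer of the set $A_\circ$ under this action.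 Let $\omega_1=w_1w_0$, where $w_0$ is the longest element of $W$ and $w_1$ is the longest element of the subgroup generated by the reflections in $\alpha_2,\dots,\alpha_\ell$. Then $W_{A_\circ}=\{1,\omega_1\}$, and for every positive integer $q$ and every $\omega\in W_{A_\circ}$ $$\chi_{\Phi,q}(\omega)=\begin{cases} (q-1)(q-3)\cdots(q-(2\ell-1)) & \text{if } \omega=1 \text{ and } q \text{ is odd},\\ (q-2)(q-4)\cdots(q-2(\ell-1))\,(q-\ell) & \text{if } \omega=1 \text{ and } q \text{ is even},\\ 0 & \text{if } \omega=\omega_1 \text{ and } q \text{ is odd},\\ (q-2)(q-4)\cdots(q-2(\ell-1)) & \text{if } \omega=\omega_1 \text{ and } q \text{ is even}. \end{cases}$$ -/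

import Mathlib

open scoped RealInnerProductSpace

namespace CoxeterCharacter

/-! ### Longest elements -/

section Length

variable {G : Type*} [Group G]

/-- The word length of `w` with respect to `S`: the least length of an expression of `w` as a
product of elements of `S`. It is only used for sets `S` of involutions and for `w` in the group
generated by `S`, where such expressions exist. -/
noncomputable def wordLength (S : Set G) (w : G) : ℕ :=
  sInf {n | ∃ l : List G, (∀ s ∈ l, s ∈ S) ∧ l.prod = w ∧ l.length = n}

/-- `w` is an element of maximal word length in the subgroup generated by `S`. -/
def IsLongest (S : Set G) (w : G) : Prop :=
  w ∈ Subgroup.closure S ∧ ∀ v ∈ Subgroup.closure S, wordLength S v ≤ wordLength S w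

theorem exists_isLongest [Finite G] (S : Set G) : ∃ w, IsLongest S w := by
  obtain ⟨w, hw, h⟩ := Set.exists_max_image (Subgroup.closure S : Set G) (wordLength S)
    (Set.toFinite _) ⟨1, one_mem _⟩
  exact ⟨w, hw, h⟩

/-- The longest element of the subgroup generated by `S` (it is unique when `S` is a set of simple
reflections of a finite reflection group). -/
noncomputable def longestElement [Finite G] (S : Set G) : G :=
  (exists_isLongest S).choose

end Length

variable {ι E N : Type*} [NormedAddCommGroup E] [InnerProductSpace ℝ E]
  [AddCommGroup N] [Module ℝ N]

/-- The root pairing `P` is a root system in the Euclidean space `E` (with set of roots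
`Set.range P.root`): the coroot of `α`, seen as a linear form on `E`, is
`x ↦ 2 (α, x) / (α, α)`, so that the reflection in `α` is the orthogonal reflection. -/
class IsEuclidean (P : RootPairing ι ℝ E N) : Prop where
  toLinearMap_coroot (i : ι) (x : E) :
    P.toLinearMap x (P.coroot i) = 2 * ⟪P.root i, x⟫ / ⟪P.root i, P.root i⟫

section Basic

variable (P : RootPairing ι ℝ E N)

/-- The Weyl group acts on `E` by isometries. -/
theorem inner_smul_smul [IsEuclidean P] (w : P.weylGroup) (x y : E) :
    ⟪w • x, w • y⟫ = ⟪x, y⟫ := by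
  obtain ⟨g, hg⟩ := w
  change ⟪g • x, g • y⟫ = ⟪x, y⟫
  induction hg using RootPairing.weylGroup.induction generalizing x y with
  | mem i =>
    have h0 : ⟪P.root i, P.root i⟫ ≠ 0 := inner_self_ne_zero.mpr (P.ne_zero i)
    simp only [RootPairing.Equiv.reflection_smul, RootPairing.reflection_apply,
      RootPairing.coroot', LinearMap.flip_apply, IsEuclidean.toLinearMap_coroot,
      inner_sub_left, inner_sub_right, real_inner_smul_left, real_inner_smul_right]
    rw [real_inner_comm (P.root i) x]
    field_simp
    ring
  | one => simp
  | mul g₁ g₂ h₁ h₂ ih₁ ih₂ => rw [mul_smul, mul_smul, ih₁, ih₂]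

instance weylGroup_finite [Finite ι] [P.IsRootSystem] : Finite P.weylGroup := by
  refine Finite.of_injective (fun w : P.weylGroup => RootPairing.Equiv.indexHom P w) ?_
  intro v w h
  apply Subtype.ext
  apply RootPairing.Equiv.weightHom_injective P
  have hroot (i : ι) : v • P.root i = w • P.root i := by
    rw [P.weylGroup_apply_root, P.weylGroup_apply_root]
    exact congrArg (fun f : ι ≃ ι => P.root (f i)) h
  apply LinearEquiv.toLinearMap_injective
  refine LinearMap.ext_on_range (RootPairing.IsRootSystem.span_root_eq_top (P := P)) ?_
  exact hroot

/-- The coweight lattice `Z`: all `x` with `(α, x) ∈ ℤ` for every root `α`. -/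
def coweightLattice : AddSubgroup E where
  carrier := {x | ∀ i, ∃ n : ℤ, ⟪P.root i, x⟫ = n}
  zero_mem' i := ⟨0, by simp⟩
  add_mem' {x y} hx hy i := by
    obtain ⟨m, hm⟩ := hx i
    obtain ⟨n, hn⟩ := hy i
    exact ⟨m + n, by rw [inner_add_right, hm, hn]; push_cast; rfl⟩
  neg_mem' {x} hx i := by
    obtain ⟨m, hm⟩ := hx i
    exact ⟨-m, by rw [inner_neg_right, hm]; push_cast; rfl⟩

/-- The coweight lattice is stable under the Weyl group. -/
theorem smul_mem_coweightLattice [IsEuclidean P] (w : P.weylGroup) {x : E}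
    (hx : x ∈ coweightLattice P) : w • x ∈ coweightLattice P := by
  intro i
  obtain ⟨n, hn⟩ := hx (P.weylGroupToPerm w⁻¹ i)
  refine ⟨n, ?_⟩
  rw [← hn, ← P.weylGroup_apply_root, ← inner_smul_smul P w (w⁻¹ • P.root i), smul_inv_smul]

/-- The action of an element of the Weyl group on the coweight lattice. -/
noncomputable def latticeAction [IsEuclidean P] (w : P.weylGroup) :
    coweightLattice P →+ coweightLattice P where
  toFun x := ⟨w • (x : E), smul_mem_coweightLattice P w x.2⟩
  map_zero' := Subtype.ext (smul_zero w)
  map_add' x y := Subtype.ext (smul_add w (x : E) (y : E))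

/-- The sublattice `qZ` of `Z`. -/
def multiples (q : ℕ) : AddSubgroup (coweightLattice P) :=
  (nsmulAddMonoidHom q : coweightLattice P →+ coweightLattice P).range

/-- The action of `w` on `Z / qZ`, sending the class of `x` to the class of `w x`. -/
noncomputable def modAction [IsEuclidean P] (q : ℕ) (w : P.weylGroup) :
    coweightLattice P ⧸ multiples P q →+ coweightLattice P ⧸ multiples P q :=
  QuotientAddGroup.map _ _ (latticeAction P w) (by
    rintro _ ⟨y, rfl⟩
    exact ⟨latticeAction P w y, (map_nsmul (latticeAction P w) q y).symm⟩)

/-- The complement `M(Φ; q)` of the Coxeter arrangement in `Z / qZ`: the classes of those `x ∈ Z`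
with `(β, x) ≢ 0 (mod q)` for all roots `β` (`β` and `-β` impose the same condition, so this is the
same as asking it for the positive roots). -/
def complement (q : ℕ) : Set (coweightLattice P ⧸ multiples P q) :=
  {z | ∃ x : coweightLattice P, (x : coweightLattice P ⧸ multiples P q) = z ∧
    ∀ i, ¬ ∃ k : ℤ, ⟪P.root i, (x : E)⟫ = (q : ℝ) * k}

/-- The Weyl group preserves `M(Φ; q)`. -/
theorem modAction_mem_complement [IsEuclidean P] (q : ℕ) (w : P.weylGroup)
    {z : coweightLattice P ⧸ multiples P q} (hz : z ∈ complement P q) :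
    modAction P q w z ∈ complement P q := by
  obtain ⟨x, rfl, hx⟩ := hz
  refine ⟨latticeAction P w x, rfl, fun i ⟨k, hk⟩ => hx (P.weylGroupToPerm w⁻¹ i) ⟨k, ?_⟩⟩
  rw [← hk, ← P.weylGroup_apply_root, ← inner_smul_smul P w (w⁻¹ • P.root i), smul_inv_smul]
  rfl

/-- The value at `w` of the permutation character `χ_{Φ,q}` of the Weyl group on `M(Φ; q)`:
the number of points of `M(Φ; q)` fixed by `w`. -/
noncomputable def chi [IsEuclidean P] (q : ℕ) (w : P.weylGroup) : ℕ :=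
  {z ∈ complement P q | modAction P q w z = z}.ncard

end Basic

section Base

variable {P : RootPairing ι ℝ E N} (b : P.Base)

/-- `P.root k` is the highest root with respect to the base `b`: subtracting any root from it gives
a combination of simple roots with nonnegative integer coefficients. -/
def IsHighestRoot (k : ι) : Prop :=
  ∀ i, P.root k - P.root i ∈ AddSubmonoid.closure (P.root '' b.support)

/-- The fundamental alcove `A_∘` (an irreducible reduced root system has exactly one highest
root). -/
def fundamentalAlcove : Set E :=
  {x | (∀ i ∈ b.support, 0 < ⟪P.root i, x⟫) ∧ ∀ k, IsHighestRoot b k → ⟪P.root k, x⟫ < 1}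

/-- The half-open fundamental parallelepiped `P^⋄` of the coweight lattice. -/
def parallelepiped : Set E :=
  {x | ∀ i ∈ b.support, 0 < ⟪P.root i, x⟫ ∧ ⟪P.root i, x⟫ ≤ 1}

/-- The image of `C ⊆ P^⋄` under the action `ρ^⋄(w)` of `w` on `P^⋄`, where `ρ^⋄(w)(x)` is the
unique point of `P^⋄` that is congruent to `w x` modulo the coweight lattice. -/
def alcoveImage (w : P.weylGroup) (C : Set E) : Set E :=
  {y ∈ parallelepiped b | ∃ x ∈ C, y - w • x ∈ coweightLattice P}

/-- The stabilizer `W_{A_∘}` of the fundamental alcove under the action `ρ^⋄`. -/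
def alcoveStabilizer : Set P.weylGroup :=
  {w | alcoveImage b w (fundamentalAlcove b) = fundamentalAlcove b}

variable [Finite ι] [P.IsRootSystem]

/-- The longest element of the subgroup of the Weyl group generated by the reflections in the
roots indexed by `I`. It is used for sets of simple roots. -/
noncomputable def longest (P : RootPairing ι ℝ E N) [P.IsRootSystem] (I : Set ι) : P.weylGroup :=
  longestElement (RootPairing.weylGroup.ofIdx P '' I)

/-- The element `ω_j = w_j w_0` of the Weyl group, for a simple root `α_j`: here `w_0` is the
longest element of the Weyl group and `w_j` that of the parabolic subgroup obtained by
omitting `α_j`. -/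
noncomputable def omega (j : b.support) : P.weylGroup :=
  longest P ((b.support : Set ι) \ {(j : ι)}) * longest P (b.support : Set ι)

end Base

end CoxeterCharacter

/-!
Number the simple roots from `0`. In type `B` the sums `ε_k = α_k + ⋯ + α_{ℓ-1}` are orthogonal of
equal length: the roots are the `±ε_a` and the `±ε_a ± ε_c`, and the Weyl group consists of all
signed permutations of the `ε_k`. In the coordinates `x_k = (ε_k, x)` the coweight lattice is
`ℤ ^ ℓ` and the fundamental alcove is given by `x_0 > ⋯ > x_{ℓ-1} > 0` and `x_0 + x_1 < 1`. The
element `ω` changes the sign of `x_0` only, so modulo the coweight lattice it acts on the alcove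
as the flip `x_0 ↦ 1 - x_0`. Conversely, if a signed permutation sends a point `c` of the alcove,
up to integers, to a point of the alcove with all coordinates less than `1 / 2`, then the image is
`c` or its flip, because all coordinates of `c` lie between `0` and `1` and only `c_0` can exceed
`1 / 2`.

Reducing coordinates modulo `q` turns `M(Φ; q)` into the set of vectors over `ZMod q` with
`x_i ≠ 0` and `x_i ≠ ±x_j`. Those with all `2 x_i ≠ 0` are counted one coordinate at a time, each
new coordinate avoiding the `±x_j` already chosen. For odd `q` they are all of `M(Φ; q)`; for even
`q`, each remaining point has exactly one coordinate equal to `q / 2`. A point is fixed by `ω` if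
and only if `x_0 = -x_0`, which forces `q` to be even and `x_0 = q / 2`.
-/

namespace CoxeterCharacter

section WordLength

variable {G : Type*} [Group G] {S : Set G}

theorem exists_prod_eq_length_eq_wordLength (hS : S⁻¹ ⊆ S) {w : G}
    (hw : w ∈ Subgroup.closure S) :
    ∃ l : List G, (∀ s ∈ l, s ∈ S) ∧ l.prod = w ∧ l.length = wordLength S w := by
  refine Nat.sInf_mem (s := {n | ∃ l : List G, (∀ s ∈ l, s ∈ S) ∧ l.prod = w ∧ l.length = n}) ?_
  rw [← Subgroup.mem_toSubmonoid, Subgroup.closure_toSubmonoid, Set.union_eq_left.2 hS] at hw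
  obtain ⟨l, hl, hprod⟩ := Submonoid.exists_list_of_mem_closure hw
  exact ⟨l.length, l, hl, hprod, rfl⟩

theorem wordLength_prod_le {l : List G} (hl : ∀ s ∈ l, s ∈ S) :
    wordLength S l.prod ≤ l.length :=
  Nat.sInf_le ⟨l, hl, rfl, rfl⟩

theorem isLongest_longestElement [Finite G] (S : Set G) : IsLongest S (longestElement S) :=
  (exists_isLongest S).choose_spec

end WordLength

section WeylGroup

open RootPairing

variable {ι R M N : Type*} [CommRing R] [AddCommGroup M] [Module R M] [AddCommGroup N] [Module R N]
  {P : RootPairing ι R M N}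

theorem ofIdx_inv (i : ι) : (weylGroup.ofIdx P i)⁻¹ = weylGroup.ofIdx P i :=
  Subtype.ext (Equiv.reflection_inv P i)

theorem ofIdx_mul_self (i : ι) : weylGroup.ofIdx P i * weylGroup.ofIdx P i = 1 :=
  mul_eq_one_iff_inv_eq.2 (ofIdx_inv i)

theorem weylGroup_ext {v w : P.weylGroup} (h : ∀ x : M, v • x = w • x) : v = w :=
  Subtype.ext (Equiv.weightHom_injective P
    (LinearEquiv.toLinearMap_injective (LinearMap.ext h)))

theorem ofIdx_smul_eq_reflection (i : ι) (x : M) :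
    weylGroup.ofIdx P i • x = P.reflection i x := rfl

theorem conj_ofIdx (w : P.weylGroup) (i : ι) :
    w * weylGroup.ofIdx P i * w⁻¹ = weylGroup.ofIdx P (P.weylGroupToPerm w i) := by
  obtain ⟨g, hg⟩ := w
  induction hg using weylGroup.induction generalizing i with
  | mem j =>
    refine weylGroup_ext fun x => ?_
    change (weylGroup.ofIdx P j * weylGroup.ofIdx P i * (weylGroup.ofIdx P j)⁻¹) • x =
      P.reflection (P.reflectionPerm j i) x
    rw [ofIdx_inv, P.reflection_reflectionPerm]
    rfl
  | one =>
    change 1 * weylGroup.ofIdx P i * 1⁻¹ = _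
    rw [one_mul, inv_one, mul_one]
    rfl
  | mul g₁ g₂ h₁ h₂ ih₁ ih₂ =>
    have hmul : (⟨g₁ * g₂, mul_mem h₁ h₂⟩ : P.weylGroup) = ⟨g₁, h₁⟩ * ⟨g₂, h₂⟩ := rfl
    rw [hmul, mul_inv_rev, map_mul, Equiv.Perm.mul_apply, ← ih₁, ← ih₂]
    group

theorem weylGroupToPerm_mul_ofIdx_self (w : P.weylGroup) (i : ι) :
    P.root (P.weylGroupToPerm (w * weylGroup.ofIdx P i) i) =
      -P.root (P.weylGroupToPerm w i) := by
  rw [← P.weylGroup_apply_root, ← P.weylGroup_apply_root, mul_smul, ofIdx_smul_eq_reflection,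
    P.reflection_apply_self, smul_neg]

end WeylGroup

section Base

open RootPairing

variable {ι R M N : Type*} [CommRing R] [AddCommGroup M] [Module R M] [AddCommGroup N] [Module R N]
  {P : RootPairing ι R M N} {b : P.Base}

theorem neg_root_mem_closure_of_not_isPos [CharZero R] {i : ι} (hi : ¬ b.IsPos i) :
    -P.root i ∈ AddSubmonoid.closure (P.root '' b.support) := by
  obtain ⟨f, -, hf | hf⟩ := b.exists_root_eq_sum_nat_or_neg i
  · have hheight : b.height i = ∑ j ∈ b.support, (f j : ℤ) :=
      Base.height_eq_sum (f := fun j => (f j : ℤ)) (by simpa using hf)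
    refine absurd (b.isPos_iff'.2 ?_) hi
    rw [hheight]
    exact Finset.sum_nonneg fun j _ => Int.natCast_nonneg _
  · rw [hf, neg_neg]
    exact sum_mem fun j hj => nsmul_mem (AddSubmonoid.subset_closure (Set.mem_image_of_mem _ hj)) _

variable [CharZero R] [IsDomain R] [Finite ι] [P.IsCrystallographic] [P.IsReduced]

variable (b) in
theorem closure_ofIdx_support :
    Subgroup.closure (weylGroup.ofIdx P '' (b.support : Set ι)) = ⊤ := by
  set H := Subgroup.closure (weylGroup.ofIdx P '' (b.support : Set ι))
  have simple_mem {j : ι} (hj : j ∈ b.support) : weylGroup.ofIdx P j ∈ H :=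
    Subgroup.subset_closure ⟨j, hj, rfl⟩
  have conj_mem (i j : ι) (hi : weylGroup.ofIdx P i ∈ H) (hj : weylGroup.ofIdx P j ∈ H) :
      weylGroup.ofIdx P (P.reflectionPerm j i) ∈ H := by
    change weylGroup.ofIdx P (P.weylGroupToPerm (weylGroup.ofIdx P j) i) ∈ H
    rw [← conj_ofIdx]
    exact mul_mem (mul_mem hj hi) (inv_mem hj)
  have ofIdx_mem (i : ι) : weylGroup.ofIdx P i ∈ H :=
    b.induction_reflect i (p := fun i => weylGroup.ofIdx P i ∈ H)
      (fun i hi => conj_mem i i hi hi) (fun i hi => simple_mem hi)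
      (fun i j hi hj => conj_mem i j hi (simple_mem hj))
  refine (Subgroup.eq_top_iff' H).2 fun ⟨g, hg⟩ => ?_
  induction hg using weylGroup.induction with
  | mem i => exact ofIdx_mem i
  | one => exact one_mem H
  | mul g₁ g₂ h₁ h₂ ih₁ ih₂ => exact mul_mem ih₁ ih₂

variable {J : Set ι}

/-- The exchange condition. Reading the word from the right, some letter `s_i` turns a positive
root negative; that root is then `α_i`, and the letter can be deleted. -/
theorem exists_prod_eq_mul_ofIdx (hJ : J ⊆ b.support) {j : ι} (hj : j ∈ b.support)
    {l : List P.weylGroup} (hl : ∀ s ∈ l, s ∈ weylGroup.ofIdx P '' J)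
    (hneg : ¬ b.IsPos (P.weylGroupToPerm l.prod j)) :
    ∃ l' : List P.weylGroup, (∀ s ∈ l', s ∈ weylGroup.ofIdx P '' J) ∧
      l'.prod = l.prod * weylGroup.ofIdx P j ∧ l'.length + 1 = l.length := by
  induction l with
  | nil => exact absurd (Base.isPos_of_mem_support hj) hneg
  | cons s l ih =>
    have hlJ : ∀ t ∈ l, t ∈ weylGroup.ofIdx P '' J := fun t ht => hl t (List.mem_cons_of_mem s ht)
    obtain ⟨i, hi, rfl⟩ := hl s List.mem_cons_self
    by_cases hpos : b.IsPos (P.weylGroupToPerm l.prod j)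
    · have hroot : P.weylGroupToPerm l.prod j = i := by
        by_contra hne
        refine hneg ?_
        rw [List.prod_cons, map_mul]
        exact hpos.reflectionPerm (hJ hi) hne
      refine ⟨l, hlJ, ?_, rfl⟩
      rw [List.prod_cons, ← hroot, ← conj_ofIdx, inv_mul_cancel_right, mul_assoc,
        ofIdx_mul_self, mul_one]
    · obtain ⟨l', hl', hprod, hlength⟩ := ih hlJ hpos
      refine ⟨weylGroup.ofIdx P i :: l', ?_, ?_, ?_⟩
      · exact List.forall_mem_cons.2 ⟨⟨i, hi, rfl⟩, hl'⟩
      · rw [List.prod_cons, hprod, List.prod_cons, mul_assoc]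
      · rw [List.length_cons, hlength, List.length_cons]

theorem IsLongest.not_isPos (hJ : J ⊆ b.support) {w : P.weylGroup}
    (hw : IsLongest (weylGroup.ofIdx P '' J) w) {j : ι} (hj : j ∈ J) :
    ¬ b.IsPos (P.weylGroupToPerm w j) := by
  intro hpos
  set v := w * weylGroup.ofIdx P j with hv
  have hinv : (weylGroup.ofIdx P '' J)⁻¹ ⊆ weylGroup.ofIdx P '' J := by
    rintro s ⟨i, hi, his⟩
    exact ⟨i, hi, by rw [← ofIdx_inv, his, inv_inv]⟩
  have hvJ : v ∈ Subgroup.closure (weylGroup.ofIdx P '' J) :=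
    mul_mem hw.1 (Subgroup.subset_closure ⟨j, hj, rfl⟩)
  obtain ⟨l, hl, hprod, hlength⟩ := exists_prod_eq_length_eq_wordLength hinv hvJ
  have hneg : ¬ b.IsPos (P.weylGroupToPerm l.prod j) := by
    have hidx : P.weylGroupToPerm v j = P.reflectionPerm (P.weylGroupToPerm w j)
        (P.weylGroupToPerm w j) := by
      refine P.root.injective ?_
      rw [hv, weylGroupToPerm_mul_ofIdx_self, P.root_reflectionPerm, P.reflection_apply_self]
    rw [hprod, hidx]
    exact fun h => (Base.IsPos.neg_iff_not b _).1 h hpos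
  obtain ⟨l', hl', hprod', hlength'⟩ := exists_prod_eq_mul_ofIdx hJ (hJ hj) hl hneg
  have hw_prod : l'.prod = w := by
    rw [hprod', hprod, hv, mul_assoc, ofIdx_mul_self, mul_one]
  have hlt : wordLength (weylGroup.ofIdx P '' J) w < wordLength (weylGroup.ofIdx P '' J) v := by
    have := wordLength_prod_le hl'
    rw [hw_prod] at this
    omega
  exact hlt.not_ge (hw.2 v hvJ)

end Base

section PositiveCone

variable {ι K M N : Type*} [Field K] [LinearOrder K] [IsStrictOrderedRing K] [AddCommGroup M]
  [Module K M] [AddCommGroup N] [Module K N] {P : RootPairing ι K M N} [P.IsRootSystem]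
  {b : P.Base}

theorem repr_nonneg_of_mem_closure {x : M} (hx : x ∈ AddSubmonoid.closure (P.root '' b.support))
    (i : b.support) : 0 ≤ b.toWeightBasis.repr x i := by
  classical
  induction hx using AddSubmonoid.closure_induction with
  | mem x hx =>
    obtain ⟨j, hj, rfl⟩ := hx
    rw [← b.toWeightBasis_apply ⟨j, hj⟩, Module.Basis.repr_self, Finsupp.single_apply]
    split_ifs <;> simp
  | zero => simp
  | add x y _ _ hx hy => simpa using add_nonneg hx hy

theorem eq_zero_of_mem_closure_of_neg_mem_closure {x : M}
    (hx : x ∈ AddSubmonoid.closure (P.root '' b.support))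
    (hneg : -x ∈ AddSubmonoid.closure (P.root '' b.support)) : x = 0 := by
  refine b.toWeightBasis.ext_elem fun i => le_antisymm ?_ ?_
  · simpa using repr_nonneg_of_mem_closure hneg i
  · simpa using repr_nonneg_of_mem_closure hx i

end PositiveCone

theorem perm_eq_one_of_lt_succ {n : ℕ} {σ : Equiv.Perm (Fin (n + 1))}
    (h : ∀ j : Fin n, σ j.castSucc < σ j.succ) : σ = 1 := by
  have hσ : StrictMono σ := Fin.strictMono_iff_lt_succ.2 h
  ext k
  exact Fin.coe_orderIso_apply (hσ.orderIsoOfSurjective σ σ.surjective) k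

/-- The sums `ε_k = α_k + ⋯ + α_n` of simple roots. For a root system of type `B` in the standard
numbering they are the usual orthogonal coordinate vectors. -/
def eps {ι R M N : Type*} [CommRing R] [AddCommGroup M] [Module R M] [AddCommGroup N] [Module R N]
    {P : RootPairing ι R M N} {b : P.Base} {n : ℕ} (e : Fin (n + 1) ≃ b.support)
    (k : Fin (n + 1)) : M :=
  ∑ j ∈ Finset.Ici k, P.root (e j)

section Eps

variable {ι R M N : Type*} [CommRing R] [AddCommGroup M] [Module R M] [AddCommGroup N] [Module R N]
  {P : RootPairing ι R M N} {b : P.Base} {n : ℕ} (e : Fin (n + 1) ≃ b.support)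

theorem eps_last : eps e (Fin.last n) = P.root (e (Fin.last n)) := by
  have hIci : Finset.Ici (Fin.last n) = {Fin.last n} := by
    ext j
    simp [Fin.last_le_iff]
  rw [eps, hIci, Finset.sum_singleton]

theorem eps_castSucc (j : Fin n) :
    eps e j.castSucc = P.root (e j.castSucc) + eps e j.succ := by
  have hIci : Finset.Ici j.castSucc = insert j.castSucc (Finset.Ici j.succ) := by
    ext i
    simp only [Finset.mem_Ici, Finset.mem_insert, Fin.le_def, Fin.ext_iff, Fin.val_castSucc,
      Fin.val_succ]
    omega
  rw [eps, hIci, Finset.sum_insert (by simp [Fin.le_def]), eps]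

theorem root_castSucc (j : Fin n) :
    P.root (e j.castSucc) = eps e j.castSucc - eps e j.succ := by
  rw [eps_castSucc, add_sub_cancel_right]

theorem root_simple_mem_closure (k : Fin (n + 1)) :
    P.root (e k) ∈ AddSubmonoid.closure (P.root '' b.support) :=
  AddSubmonoid.subset_closure (Set.mem_image_of_mem _ (e k).2)

theorem eps_mem_closure (k : Fin (n + 1)) :
    eps e k ∈ AddSubmonoid.closure (P.root '' b.support) :=
  sum_mem fun j _ => root_simple_mem_closure e j

theorem eps_sub_eps_mem_closure {j k : Fin (n + 1)} (hjk : j ≤ k) :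
    eps e j - eps e k ∈ AddSubmonoid.closure (P.root '' b.support) := by
  rw [eps, eps, ← Finset.sum_sdiff (Finset.Ici_subset_Ici.2 hjk), add_sub_cancel_right]
  exact sum_mem fun i _ => root_simple_mem_closure e i

end Eps

section EpsBasis

variable {ι K M N : Type*} [Field K] [AddCommGroup M] [Module K M] [AddCommGroup N] [Module K N]
  {P : RootPairing ι K M N} [P.IsRootSystem] {b : P.Base} {n : ℕ} (e : Fin (n + 1) ≃ b.support)

theorem top_le_span_eps : ⊤ ≤ Submodule.span K (Set.range (eps e)) := by
  have eps_mem (k : Fin (n + 1)) : eps e k ∈ Submodule.span K (Set.range (eps e)) :=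
    Submodule.subset_span ⟨k, rfl⟩
  rw [← b.toWeightBasis.span_eq, Submodule.span_le]
  rintro _ ⟨i, rfl⟩
  obtain ⟨k, rfl⟩ := e.surjective i
  rw [b.toWeightBasis_apply]
  induction k using Fin.lastCases with
  | last => exact eps_last e ▸ eps_mem _
  | cast j => exact root_castSucc e j ▸ sub_mem (eps_mem _) (eps_mem _)

theorem linearIndependent_eps : LinearIndependent K (eps e) := by
  refine linearIndependent_of_top_le_span_of_card_eq_finrank (top_le_span_eps e) ?_
  rw [Module.finrank_eq_card_basis b.toWeightBasis, Fintype.card_congr e]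

/-- The vectors `ε_k` as a basis. -/
noncomputable def epsBasis : Module.Basis (Fin (n + 1)) K M :=
  Module.Basis.mk (linearIndependent_eps e) (top_le_span_eps e)

@[simp] theorem epsBasis_apply (k : Fin (n + 1)) : epsBasis e k = eps e k :=
  Module.Basis.mk_apply _ _ k

theorem eps_ne_zero (k : Fin (n + 1)) : eps e k ≠ 0 := (linearIndependent_eps e).ne_zero k

theorem eps_injective : Function.Injective (eps e) := (linearIndependent_eps e).injective

end EpsBasis

section ActsBy

variable {ι K M N : Type*} [Field K] [AddCommGroup M] [Module K M] [AddCommGroup N] [Module K N]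
  {P : RootPairing ι K M N} {b : P.Base} {n : ℕ} {e : Fin (n + 1) ≃ b.support}

/-- `w` acts on the vectors `ε_k` as the signed permutation with underlying permutation `σ` and
signs `s`. -/
def ActsBy (e : Fin (n + 1) ≃ b.support) (w : P.weylGroup) (σ : Equiv.Perm (Fin (n + 1)))
    (s : Fin (n + 1) → ℤˣ) : Prop :=
  ∀ k, w • eps e k = s k • eps e (σ k)

variable {v w : P.weylGroup} {σ τ : Equiv.Perm (Fin (n + 1))} {s t : Fin (n + 1) → ℤˣ}

theorem actsBy_one : ActsBy e 1 1 1 := fun k => by simp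

theorem ActsBy.mul (hv : ActsBy e v σ s) (hw : ActsBy e w τ t) :
    ActsBy e (v * w) (σ * τ) (fun k => t k * s (τ k)) := fun k => by
  rw [mul_smul, hw, smul_comm, hv, smul_smul, Equiv.Perm.mul_apply]

theorem ActsBy.inv (hw : ActsBy e w σ s) : ActsBy e w⁻¹ σ⁻¹ (fun k => s (σ⁻¹ k)) := fun k => by
  rw [inv_smul_eq_iff, smul_comm, hw, smul_smul, Int.units_mul_self, one_smul,
    Equiv.Perm.coe_inv, Equiv.apply_symm_apply]

theorem ActsBy.eq [P.IsRootSystem] (hv : ActsBy e v σ s) (hw : ActsBy e w σ s) : v = w := by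
  have hlin : DistribSMul.toLinearMap K M v = DistribSMul.toLinearMap K M w :=
    (epsBasis e).ext fun k => by
      rw [epsBasis_apply]
      exact (hv k).trans (hw k).symm
  exact weylGroup_ext (LinearMap.congr_fun hlin)

/-- The vectors `±ε_a` and `±ε_a ± ε_c` with `a ≠ c`. -/
def coordRoots (e : Fin (n + 1) ≃ b.support) : Set M :=
  {x | (∃ (u : ℤˣ) (a : Fin (n + 1)), x = u • eps e a) ∨
    ∃ (u v : ℤˣ) (a c : Fin (n + 1)), a ≠ c ∧ x = u • eps e a + v • eps e c}

theorem root_simple_mem_coordRoots (k : Fin (n + 1)) : P.root (e k) ∈ coordRoots e := by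
  induction k using Fin.lastCases with
  | last => exact .inl ⟨1, Fin.last n, by rw [one_smul, eps_last]⟩
  | cast j =>
    refine .inr ⟨1, -1, j.castSucc, j.succ, Fin.castSucc_lt_succ.ne, ?_⟩
    rw [root_castSucc, one_smul, Units.neg_smul, one_smul, sub_eq_add_neg]

theorem ActsBy.smul_mem_coordRoots (hw : ActsBy e w σ s) {x : M} (hx : x ∈ coordRoots e) :
    w • x ∈ coordRoots e := by
  rcases hx with ⟨u, a, rfl⟩ | ⟨u, v, a, c, hac, rfl⟩
  · exact .inl ⟨u * s a, σ a, by rw [smul_comm, hw, smul_smul]⟩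
  · refine .inr ⟨u * s a, v * s c, σ a, σ c, σ.injective.ne hac, ?_⟩
    rw [smul_add, smul_comm w u, smul_comm w v, hw, hw, smul_smul, smul_smul]

end ActsBy

section CartanMatrix

open RootPairing

variable {ι K M N : Type*} [Field K] [AddCommGroup M] [Module K M] [AddCommGroup N]
  [Module K N] {P : RootPairing ι K M N} [P.IsCrystallographic] {b : P.Base} {n : ℕ}
  {e : Fin (n + 1) ≃ b.support}

/-- The Cartan matrix with respect to the numbering `e` of the simple roots is of type `B`. -/
def IsTypeB (e : Fin (n + 1) ≃ b.support) : Prop :=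
  ∀ i j, b.cartanMatrix (e i) (e j) = CartanMatrix.B (n + 1) i j

theorem IsTypeB.pairing_eq (h : IsTypeB e) (i j : Fin (n + 1)) :
    P.pairing (e i) (e j) = (CartanMatrix.B (n + 1) i j : K) := by
  rw [← h i j, ← eq_intCast (algebraMap ℤ K), ← b.algebraMap_cartanMatrixIn_apply ℤ]

theorem IsTypeB.coroot'_eps_castSucc (h : IsTypeB e) (j : Fin n) (k : Fin (n + 1)) :
    P.coroot' (e j.castSucc) (eps e k) =
      (if k = j.castSucc then 1 else 0) - (if k = j.succ then 1 else 0) := by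
  induction k using Fin.reverseInduction with
  | last =>
    rw [eps_last, P.root_coroot'_eq_pairing, h.pairing_eq]
    simp only [CartanMatrix.B, Matrix.of_apply, Fin.ext_iff, Fin.val_last, Fin.val_castSucc,
      Fin.val_succ]
    have := j.2
    split_ifs <;> first | omega | norm_num
  | cast i ih =>
    rw [eps_castSucc, map_add, ih, P.root_coroot'_eq_pairing, h.pairing_eq]
    simp only [CartanMatrix.B, Matrix.of_apply, Fin.ext_iff, Fin.val_castSucc, Fin.val_succ]
    have := j.2
    split_ifs <;> first | omega | norm_num

theorem IsTypeB.coroot'_eps_last (h : IsTypeB e) (k : Fin (n + 1)) :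
    P.coroot' (e (Fin.last n)) (eps e k) = if k = Fin.last n then 2 else 0 := by
  induction k using Fin.reverseInduction with
  | last => simp [eps_last]
  | cast i ih =>
    rw [eps_castSucc, map_add, ih, P.root_coroot'_eq_pairing, h.pairing_eq]
    simp only [CartanMatrix.B, Matrix.of_apply, Fin.ext_iff, Fin.val_castSucc, Fin.val_succ,
      Fin.val_last]
    have := i.2
    split_ifs <;> first | omega | norm_num

theorem IsTypeB.actsBy_ofIdx_castSucc (h : IsTypeB e) (j : Fin n) :
    ActsBy e (weylGroup.ofIdx P (e j.castSucc)) (Equiv.swap j.castSucc j.succ) 1 := fun k => by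
  have hne : j.castSucc ≠ j.succ := Fin.castSucc_lt_succ.ne
  rw [ofIdx_smul_eq_reflection, P.reflection_apply, h.coroot'_eps_castSucc, root_castSucc,
    Pi.one_apply, one_smul]
  rcases eq_or_ne k j.castSucc with rfl | hk
  · simp [hne]
  rcases eq_or_ne k j.succ with rfl | hk'
  · simp [hne.symm]
  · simp [hk, hk', Equiv.swap_apply_of_ne_of_ne]

theorem IsTypeB.actsBy_ofIdx_last (h : IsTypeB e) :
    ActsBy e (weylGroup.ofIdx P (e (Fin.last n))) 1 (Pi.mulSingle (Fin.last n) (-1)) := fun k => by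
  rw [ofIdx_smul_eq_reflection, P.reflection_apply, h.coroot'_eps_last, ← eps_last]
  rcases eq_or_ne k (Fin.last n) with rfl | hk
  · simp only [if_true, Pi.mulSingle_eq_same, Equiv.Perm.one_apply, Units.neg_smul, one_smul]
    module
  · simp [hk]

theorem IsTypeB.exists_actsBy_ofIdx (h : IsTypeB e) (i : Fin (n + 1)) :
    ∃ σ s, ActsBy e (weylGroup.ofIdx P (e i)) σ s := by
  induction i using Fin.lastCases with
  | last => exact ⟨_, _, h.actsBy_ofIdx_last⟩
  | cast j => exact ⟨_, _, h.actsBy_ofIdx_castSucc j⟩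

theorem IsTypeB.exists_actsBy [CharZero K] [Finite ι] [P.IsReduced] (h : IsTypeB e)
    (w : P.weylGroup) : ∃ σ s, ActsBy e w σ s := by
  have hw : w ∈ Subgroup.closure (weylGroup.ofIdx P '' (b.support : Set ι)) := by
    rw [closure_ofIdx_support]
    trivial
  induction hw using Subgroup.closure_induction with
  | mem w hw =>
    obtain ⟨i, hi, rfl⟩ := hw
    obtain ⟨k, hk⟩ := e.surjective ⟨i, hi⟩
    simpa [hk] using h.exists_actsBy_ofIdx k
  | one => exact ⟨_, _, actsBy_one⟩
  | mul v w _ _ hv hw =>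
    obtain ⟨σ, s, hv⟩ := hv
    obtain ⟨τ, t, hw⟩ := hw
    exact ⟨_, _, hv.mul hw⟩
  | inv w _ hw =>
    obtain ⟨σ, s, hw⟩ := hw
    exact ⟨_, _, hw.inv⟩

theorem IsTypeB.exists_actsBy_perm (h : IsTypeB e) (σ : Equiv.Perm (Fin (n + 1))) :
    ∃ w, ActsBy e w σ 1 := by
  have hσ : σ ∈ Submonoid.closure (Set.range fun i : Fin n => Equiv.swap i.castSucc i.succ) := by
    rw [Equiv.Perm.mclosure_swap_castSucc_succ]
    trivial
  induction hσ using Submonoid.closure_induction with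
  | mem σ hσ =>
    obtain ⟨j, rfl⟩ := hσ
    exact ⟨_, h.actsBy_ofIdx_castSucc j⟩
  | one => exact ⟨_, actsBy_one⟩
  | mul σ τ _ _ hσ hτ =>
    obtain ⟨v, hv⟩ := hσ
    obtain ⟨w, hw⟩ := hτ
    exact ⟨v * w, hv.mul hw⟩

theorem IsTypeB.exists_actsBy_mulSingle (h : IsTypeB e) (a : Fin (n + 1)) (u : ℤˣ) :
    ∃ w, ActsBy e w 1 (Pi.mulSingle a u) := by
  rcases Int.units_eq_one_or u with rfl | rfl
  · exact ⟨1, by simpa using actsBy_one⟩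
  obtain ⟨w, hw⟩ := h.exists_actsBy_perm (Equiv.swap a (Fin.last n))
  refine ⟨_, fun k => (hw.inv.mul (h.actsBy_ofIdx_last.mul hw) k).trans ?_⟩
  have hk : (Pi.mulSingle (Fin.last n) (-1) : Fin (n + 1) → ℤˣ) (Equiv.swap a (Fin.last n) k) =
      (Pi.mulSingle a (-1) : Fin (n + 1) → ℤˣ) k := by
    simp only [Pi.mulSingle_apply, Equiv.swap_apply_eq_iff, Equiv.swap_apply_right]
  simp [hk]

theorem IsTypeB.exists_weylGroup_actsBy (h : IsTypeB e) (σ : Equiv.Perm (Fin (n + 1)))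
    (s : Fin (n + 1) → ℤˣ) : ∃ w, ActsBy e w σ s := by
  have exists_sign : ∃ w, ActsBy e w 1 s := by
    rw [← Finset.univ_prod_mulSingle s]
    refine Finset.prod_induction _ (fun t => ∃ w, ActsBy e w 1 t) ?_ ⟨1, actsBy_one⟩
      fun a _ => h.exists_actsBy_mulSingle a (s a)
    rintro t t' ⟨v, hv⟩ ⟨w, hw⟩
    exact ⟨w * v, hw.mul hv⟩
  obtain ⟨v, hv⟩ := h.exists_actsBy_perm σ
  obtain ⟨w, hw⟩ := exists_sign
  exact ⟨v * w, by simpa using hv.mul hw⟩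

theorem IsTypeB.exists_root_eq_smul_eps (h : IsTypeB e) (u : ℤˣ) (a : Fin (n + 1)) :
    ∃ i, P.root i = u • eps e a := by
  obtain ⟨w, hw⟩ := h.exists_weylGroup_actsBy (Equiv.swap a (Fin.last n)) fun _ => u
  refine ⟨P.weylGroupToPerm w (e (Fin.last n)), ?_⟩
  rw [← P.weylGroup_apply_root, ← eps_last, hw, Equiv.swap_apply_right]

end CartanMatrix

theorem exists_perm_apply_eq_apply_eq {α : Type*} {x y a c : α} (hxy : x ≠ y) (hac : a ≠ c) :
    ∃ σ : Equiv.Perm α, σ x = a ∧ σ y = c := by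
  classical
  have ha : Equiv.swap x a y ≠ a := by
    rw [Ne, Equiv.swap_apply_eq_iff, Equiv.swap_apply_right]
    exact hxy.symm
  refine ⟨Equiv.swap (Equiv.swap x a y) c * Equiv.swap x a, ?_, ?_⟩
  · simp [Equiv.swap_apply_of_ne_of_ne ha.symm hac]
  · simp

section Roots

open RootPairing

variable {ι K M N : Type*} [Field K] [AddCommGroup M] [Module K M] [AddCommGroup N]
  [Module K N] {P : RootPairing ι K M N} [P.IsCrystallographic] {b : P.Base} {n : ℕ}
  {e : Fin (n + 1) ≃ b.support}

theorem IsTypeB.exists_root_eq_smul_eps_add (h : IsTypeB e) (u v : ℤˣ) {a c : Fin (n + 1)}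
    (hac : a ≠ c) : ∃ i, P.root i = u • eps e a + v • eps e c := by
  obtain ⟨m, rfl⟩ : ∃ m, n = m + 1 := by
    refine Nat.exists_eq_succ_of_ne_zero ?_
    rintro rfl
    exact hac (Subsingleton.elim (α := Fin 1) a c)
  obtain ⟨σ, ha, hc⟩ := exists_perm_apply_eq_apply_eq (Fin.castSucc_lt_succ (i := 0)).ne hac
  obtain ⟨w, hw⟩ := h.exists_weylGroup_actsBy σ fun k => if k = Fin.castSucc 0 then u else -v
  refine ⟨P.weylGroupToPerm w (e (Fin.castSucc 0)), ?_⟩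
  rw [← P.weylGroup_apply_root, root_castSucc, smul_sub, hw, hw, ha, hc]
  simp

theorem IsTypeB.range_root [CharZero K] [Finite ι] [P.IsReduced] (h : IsTypeB e) :
    Set.range P.root = coordRoots e := by
  refine Set.Subset.antisymm ?_ ?_
  · have reflect (i j : ι) (hi : P.root i ∈ coordRoots e) :
        P.root (P.reflectionPerm j i) ∈ coordRoots e := by
      obtain ⟨σ, s, hj⟩ := h.exists_actsBy (weylGroup.ofIdx P j)
      rw [P.root_reflectionPerm, ← ofIdx_smul_eq_reflection]
      exact hj.smul_mem_coordRoots hi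
    rintro _ ⟨i, rfl⟩
    refine b.induction_reflect i (p := fun i => P.root i ∈ coordRoots e)
      (fun i hi => reflect i i hi) (fun i hi => ?_) (fun i j hi _ => reflect i j hi)
    obtain ⟨k, hk⟩ := e.surjective ⟨i, hi⟩
    simpa [hk] using root_simple_mem_coordRoots (e := e) k
  · rintro _ (⟨u, a, rfl⟩ | ⟨u, v, a, c, hac, rfl⟩)
    · exact h.exists_root_eq_smul_eps u a
    · exact h.exists_root_eq_smul_eps_add u v hac

theorem IsTypeB.forall_root_iff [CharZero K] [Finite ι] [P.IsReduced] (h : IsTypeB e)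
    {p : M → Prop} : (∀ i, p (P.root i)) ↔ (∀ (u : ℤˣ) a, p (u • eps e a)) ∧
      ∀ (u v : ℤˣ) a c, a ≠ c → p (u • eps e a + v • eps e c) := by
  rw [← Set.forall_mem_range (p := p), h.range_root]
  constructor
  · exact fun hp => ⟨fun u a => hp _ (.inl ⟨u, a, rfl⟩),
      fun u v a c hac => hp _ (.inr ⟨u, v, a, c, hac, rfl⟩)⟩
  · rintro ⟨hshort, hlong⟩ _ (⟨u, a, rfl⟩ | ⟨u, v, a, c, hac, rfl⟩)
    · exact hshort u a
    · exact hlong u v a c hac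

end Roots

section SignedEps

variable {ι K M N : Type*} [Field K] [LinearOrder K] [IsStrictOrderedRing K] [AddCommGroup M]
  [Module K M] [AddCommGroup N] [Module K N] {P : RootPairing ι K M N} [P.IsRootSystem]
  {b : P.Base} {n : ℕ} {e : Fin (n + 1) ≃ b.support}

theorem eq_one_of_smul_eps_mem_closure {u : ℤˣ} {a : Fin (n + 1)}
    (h : u • eps e a ∈ AddSubmonoid.closure (P.root '' b.support)) : u = 1 := by
  rcases Int.units_eq_one_or u with rfl | rfl
  · rfl
  · rw [Units.neg_smul, one_smul] at h
    exact absurd (eq_zero_of_mem_closure_of_neg_mem_closure (eps_mem_closure e a) h)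
      (eps_ne_zero e a)

theorem units_smul_eps_eq_eps_iff {u : ℤˣ} {a c : Fin (n + 1)} :
    u • eps e a = eps e c ↔ u = 1 ∧ a = c := by
  refine ⟨fun h => ?_, fun ⟨hu, hac⟩ => by rw [hu, hac, one_smul]⟩
  obtain rfl := eq_one_of_smul_eps_mem_closure (h ▸ eps_mem_closure e c)
  exact ⟨rfl, eps_injective e (by rwa [one_smul] at h)⟩

theorem lt_of_eps_sub_eps_mem_closure {a c : Fin (n + 1)} (hac : a ≠ c)
    (h : eps e a - eps e c ∈ AddSubmonoid.closure (P.root '' b.support)) : a < c := by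
  by_contra! hca
  refine hac (eps_injective e (sub_eq_zero.1 ?_))
  refine eq_zero_of_mem_closure_of_neg_mem_closure h ?_
  rw [neg_sub]
  exact eps_sub_eps_mem_closure e hca

end SignedEps

section Longest

open RootPairing

theorem IsTypeB.ofIdx_smul_eps_of_lt {ι K M N : Type*} [Field K] [AddCommGroup M] [Module K M]
    [AddCommGroup N] [Module K N] {P : RootPairing ι K M N} [P.IsCrystallographic] {b : P.Base}
    {n : ℕ} {e : Fin (n + 1) ≃ b.support} (h : IsTypeB e) {i j : Fin (n + 1)} (hji : j < i) :
    weylGroup.ofIdx P (e i) • eps e j = eps e j := by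
  induction i using Fin.lastCases with
  | last => simp [h.actsBy_ofIdx_last j, hji.ne]
  | cast i =>
    rw [h.actsBy_ofIdx_castSucc i, Equiv.swap_apply_of_ne_of_ne hji.ne
      (hji.trans Fin.castSucc_lt_succ).ne, Pi.one_apply, one_smul]

theorem IsTypeB.smul_eps_of_notMem {ι K M N : Type*} [Field K] [AddCommGroup M] [Module K M]
    [AddCommGroup N] [Module K N] {P : RootPairing ι K M N} [P.IsCrystallographic] {b : P.Base}
    {n : ℕ} {e : Fin (n + 1) ≃ b.support} (h : IsTypeB e) {U : Set (Fin (n + 1))}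
    (hU : IsUpperSet U) {w : P.weylGroup}
    (hw : w ∈ Subgroup.closure (weylGroup.ofIdx P '' ((fun k => (e k : ι)) '' U)))
    {j : Fin (n + 1)} (hj : j ∉ U) : w • eps e j = eps e j := by
  induction hw using Subgroup.closure_induction with
  | mem w hw =>
    obtain ⟨_, ⟨i, hi, rfl⟩, rfl⟩ := hw
    exact h.ofIdx_smul_eps_of_lt (lt_of_not_ge fun hij => hj (hU hij hi))
  | one => exact one_smul _ _
  | mul v w _ _ hv hw => rw [mul_smul, hw, hv]
  | inv w _ hw => rw [inv_smul_eq_iff, hw]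

variable {ι K M N : Type*} [Field K] [LinearOrder K] [IsStrictOrderedRing K] [Finite ι]
  [AddCommGroup M] [Module K M] [AddCommGroup N] [Module K N] {P : RootPairing ι K M N}
  [P.IsCrystallographic] [P.IsReduced] {b : P.Base} {n : ℕ} {e : Fin (n + 1) ≃ b.support}
  {U : Set (Fin (n + 1))} {w : P.weylGroup}

theorem IsLongest.neg_smul_root_mem_closure
    (hw : IsLongest (weylGroup.ofIdx P '' ((fun k => (e k : ι)) '' U)) w) {k : Fin (n + 1)}
    (hk : k ∈ U) : -(w • P.root (e k)) ∈ AddSubmonoid.closure (P.root '' b.support) := by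
  have subset_support : (fun k => (e k : ι)) '' U ⊆ b.support := by
    rintro _ ⟨i, -, rfl⟩
    exact (e i).2
  rw [P.weylGroup_apply_root]
  exact neg_root_mem_closure_of_not_isPos
    (hw.not_isPos subset_support (Set.mem_image_of_mem _ hk))

theorem IsLongest.neg_smul_eps_mem_closure (hU : IsUpperSet U)
    (hw : IsLongest (weylGroup.ofIdx P '' ((fun k => (e k : ι)) '' U)) w) {k : Fin (n + 1)}
    (hk : k ∈ U) : -(w • eps e k) ∈ AddSubmonoid.closure (P.root '' b.support) := by
  rw [eps, Finset.smul_sum, ← Finset.sum_neg_distrib]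
  exact sum_mem fun i hi => hw.neg_smul_root_mem_closure (hU (Finset.mem_Ici.1 hi) hk)

/- A longest element of the parabolic subgroup maps the simple roots `ε_j - ε_{j+1}` of that
subgroup to negative roots, so once the signs are known `σ` has to be increasing. -/
theorem IsTypeB.actsBy_of_isLongest [P.IsRootSystem] [DecidablePred (· ∈ U)]
    (h : IsTypeB e) (hU : IsUpperSet U)
    (hw : IsLongest (weylGroup.ofIdx P '' ((fun k => (e k : ι)) '' U)) w) :
    ActsBy e w 1 (fun k => if k ∈ U then -1 else 1) := by
  obtain ⟨σ, s, hσ⟩ := h.exists_actsBy w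
  have hfix {j} (hj : j ∉ U) : s j = 1 ∧ σ j = j :=
    units_smul_eps_eq_eps_iff.1 ((hσ j).symm.trans (h.smul_eps_of_notMem hU hw.1 hj))
  have hsign {j} (hj : j ∈ U) : s j = -1 := by
    have hmem := hw.neg_smul_eps_mem_closure hU hj
    rw [hσ, ← Units.neg_smul] at hmem
    exact neg_eq_iff_eq_neg.1 (eq_one_of_smul_eps_mem_closure hmem)
  have hmem {j} (hj : j ∈ U) : σ j ∈ U := by
    by_contra hj'
    exact hj' (by rwa [σ.injective (hfix hj').2])
  have hlt (j : Fin n) : σ j.castSucc < σ j.succ := by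
    have hle : j.castSucc < j.succ := Fin.castSucc_lt_succ
    by_cases hj : j.castSucc ∈ U
    · refine lt_of_eps_sub_eps_mem_closure (e := e) (σ.injective.ne hle.ne) ?_
      have hneg := hw.neg_smul_root_mem_closure hj
      rwa [root_castSucc, smul_sub, hσ, hσ, hsign hj, hsign (hU hle.le hj), Units.neg_smul,
        Units.neg_smul, one_smul, one_smul, neg_sub_neg, neg_sub] at hneg
    rw [(hfix hj).2]
    by_cases hj' : j.succ ∈ U
    · exact lt_of_not_ge fun hge => hj (hU hge (hmem hj'))
    · rwa [(hfix hj').2]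
  intro k
  rw [hσ, perm_eq_one_of_lt_succ hlt]
  beta_reduce
  split_ifs with hk
  · rw [hsign hk]
  · rw [(hfix hk).1]

end Longest

section Omega

variable {ι E N : Type*} [Finite ι] [NormedAddCommGroup E] [InnerProductSpace ℝ E]
  [AddCommGroup N] [Module ℝ N] {P : RootPairing ι ℝ E N} [P.IsCrystallographic] [P.IsReduced]
  [P.IsRootSystem] {b : P.Base} {n : ℕ} {e : Fin (n + 1) ≃ b.support}

theorem IsTypeB.actsBy_longest (h : IsTypeB e) {U : Set (Fin (n + 1))}
    [DecidablePred (· ∈ U)] (hU : IsUpperSet U) :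
    ActsBy e (longest P ((fun k => (e k : ι)) '' U)) 1 (fun k => if k ∈ U then -1 else 1) :=
  h.actsBy_of_isLongest hU (isLongest_longestElement _)

theorem IsTypeB.actsBy_omega (h : IsTypeB e) :
    ActsBy e (omega b (e 0)) 1 (Pi.mulSingle 0 (-1)) := by
  have image_univ : (fun k => (e k : ι)) '' Set.univ = b.support := by
    rw [Set.image_univ, ← Function.comp_def, e.surjective.range_comp, Subtype.range_coe]
  have image_Ioi : (fun k => (e k : ι)) '' Set.Ioi 0 = (b.support : Set ι) \ {(e 0 : ι)} := by
    have Ioi_eq : Set.Ioi (0 : Fin (n + 1)) = Set.univ \ {0} := by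
      ext k
      simp [Fin.pos_iff_ne_zero]
    have inj : Function.Injective fun k => (e k : ι) := Subtype.val_injective.comp e.injective
    rw [Ioi_eq, Set.image_sdiff inj, Set.image_singleton, image_univ]
  intro k
  rw [omega, ← image_Ioi, ← image_univ]
  refine ((h.actsBy_longest (isUpperSet_Ioi 0)).mul (h.actsBy_longest isUpperSet_univ) k).trans ?_
  rcases eq_or_ne k 0 with rfl | hk
  · simp
  · simp [hk, Fin.pos_iff_ne_zero]

end Omega

section HighestRoot

section Closure

variable {ι K M N : Type*} [Field K] [AddCommGroup M] [Module K M] [AddCommGroup N] [Module K N]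
  {P : RootPairing ι K M N} {b : P.Base} {n : ℕ}

theorem eps_sub_units_smul_eps_mem_closure (e : Fin (n + 1) ≃ b.support) (u : ℤˣ)
    (a : Fin (n + 1)) :
    eps e a - u • eps e a ∈ AddSubmonoid.closure (P.root '' b.support) := by
  rcases Int.units_eq_one_or u with rfl | rfl
  · simp
  · simpa using add_mem (eps_mem_closure e a) (eps_mem_closure e a)

theorem eps_zero_add_eps_one_sub_mem_closure_of_lt (e : Fin (n + 2) ≃ b.support)
    {a c : Fin (n + 2)} (hac : a < c) :
    eps e 0 + eps e 1 - (eps e a + eps e c) ∈ AddSubmonoid.closure (P.root '' b.support) := by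
  rw [add_sub_add_comm]
  exact add_mem (eps_sub_eps_mem_closure e (Fin.zero_le a))
    (eps_sub_eps_mem_closure e (Fin.one_le_of_ne_zero (Fin.ne_zero_of_lt hac)))

theorem eps_zero_add_eps_one_sub_mem_closure (e : Fin (n + 2) ≃ b.support) {x : M}
    (hx : x ∈ coordRoots e) :
    eps e 0 + eps e 1 - x ∈ AddSubmonoid.closure (P.root '' b.support) := by
  rcases hx with ⟨u, a, rfl⟩ | ⟨u, v, a, c, hac, rfl⟩
  · have split : eps e 0 + eps e 1 - u • eps e a =
        (eps e 0 - eps e a) + eps e 1 + (eps e a - u • eps e a) := by abel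
    rw [split]
    exact add_mem (add_mem (eps_sub_eps_mem_closure e (Fin.zero_le a)) (eps_mem_closure e 1))
      (eps_sub_units_smul_eps_mem_closure e u a)
  · have split : eps e 0 + eps e 1 - (u • eps e a + v • eps e c) =
        (eps e 0 + eps e 1 - (eps e a + eps e c)) + (eps e a - u • eps e a) +
          (eps e c - v • eps e c) := by abel
    rw [split]
    refine add_mem (add_mem ?_ (eps_sub_units_smul_eps_mem_closure e u a))
      (eps_sub_units_smul_eps_mem_closure e v c)
    rcases hac.lt_or_gt with hlt | hgt
    · exact eps_zero_add_eps_one_sub_mem_closure_of_lt e hlt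
    · rw [add_comm (eps e a)]
      exact eps_zero_add_eps_one_sub_mem_closure_of_lt e hgt

end Closure

variable {ι E N : Type*} [Finite ι] [NormedAddCommGroup E] [InnerProductSpace ℝ E]
  [AddCommGroup N] [Module ℝ N] {P : RootPairing ι ℝ E N} [P.IsCrystallographic] [P.IsReduced]
  [P.IsRootSystem] {b : P.Base} {n : ℕ} {e : Fin (n + 2) ≃ b.support}

theorem IsTypeB.isHighestRoot_iff (h : IsTypeB e) (k : ι) :
    IsHighestRoot b k ↔ P.root k = eps e 0 + eps e 1 := by
  have mem_coordRoots (i : ι) : P.root i ∈ coordRoots e := h.range_root ▸ Set.mem_range_self i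
  refine ⟨fun hk => ?_, fun hk i => hk ▸ eps_zero_add_eps_one_sub_mem_closure e (mem_coordRoots i)⟩
  obtain ⟨i, hi⟩ := h.exists_root_eq_smul_eps_add 1 1 (Fin.zero_ne_one (n := n))
  rw [one_smul, one_smul] at hi
  refine sub_eq_zero.1 (eq_zero_of_mem_closure_of_neg_mem_closure (hi ▸ hk i) ?_)
  rw [neg_sub]
  exact eps_zero_add_eps_one_sub_mem_closure e (mem_coordRoots k)

end HighestRoot

section Coord

variable {ι E N : Type*} [NormedAddCommGroup E] [InnerProductSpace ℝ E] [AddCommGroup N]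
  [Module ℝ N] {P : RootPairing ι ℝ E N} {b : P.Base} {n : ℕ}

/-- The coordinates `(ε_k, x)` of a vector `x`. -/
noncomputable def coord (e : Fin (n + 1) ≃ b.support) : E →ₗ[ℝ] Fin (n + 1) → ℝ :=
  LinearMap.pi fun k => innerₗ E (eps e k)

@[simp] theorem coord_apply (e : Fin (n + 1) ≃ b.support) (x : E) (k : Fin (n + 1)) :
    coord e x k = ⟪eps e k, x⟫ := rfl

theorem inner_root_castSucc (e : Fin (n + 1) ≃ b.support) (j : Fin n) (x : E) :
    ⟪P.root (e j.castSucc), x⟫ = coord e x j.castSucc - coord e x j.succ := by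
  rw [root_castSucc, inner_sub_left, coord_apply, coord_apply]

theorem inner_root_last (e : Fin (n + 1) ≃ b.support) (x : E) :
    ⟪P.root (e (Fin.last n)), x⟫ = coord e x (Fin.last n) := by
  rw [coord_apply, eps_last]

theorem forall_inner_root_pos_iff (e : Fin (n + 1) ≃ b.support) {x : E} :
    (∀ i ∈ b.support, 0 < ⟪P.root i, x⟫) ↔
      StrictAnti (coord e x) ∧ ∀ k, 0 < coord e x k := by
  have forall_support : (∀ i ∈ b.support, 0 < ⟪P.root i, x⟫) ↔ ∀ k, 0 < ⟪P.root (e k), x⟫ :=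
    ⟨fun hx k => hx _ (e k).2, fun hx i hi => by simpa using hx (e.symm ⟨i, hi⟩)⟩
  rw [forall_support, Fin.forall_fin_succ', Fin.strictAnti_iff_succ_lt]
  simp only [inner_root_castSucc, inner_root_last, sub_pos]
  refine and_congr_right fun hanti => ⟨fun hlast k => ?_, fun hpos => hpos _⟩
  exact hlast.trans_le ((Fin.strictAnti_iff_succ_lt.2 hanti).antitone (Fin.le_last k))

theorem ActsBy.coord_smul [IsEuclidean P] {e : Fin (n + 1) ≃ b.support} {w : P.weylGroup}
    {σ : Equiv.Perm (Fin (n + 1))} {s : Fin (n + 1) → ℤˣ} (hw : ActsBy e w σ s) (x : E)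
    (k : Fin (n + 1)) : coord e (w • x) (σ k) = s k • coord e x k := by
  have eps_eq : eps e (σ k) = s k • w • eps e k := by
    rw [hw, smul_smul, Int.units_mul_self, one_smul]
  rw [coord_apply, coord_apply, eps_eq, ← inner_smul_smul P w (eps e k)]
  rcases Int.units_eq_one_or (s k) with hs | hs <;> simp [hs]

theorem IsTypeB.mem_coweightLattice_iff [Finite ι] [P.IsCrystallographic] [P.IsReduced]
    {e : Fin (n + 1) ≃ b.support} (h : IsTypeB e) {x : E} :
    x ∈ coweightLattice P ↔ ∀ k, ∃ m : ℤ, coord e x k = m := by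
  refine (h.forall_root_iff (p := fun y => ∃ m : ℤ, ⟪y, x⟫ = m)).trans
    ⟨fun hx k => by simpa using hx.1 1 k, fun hx => ?_⟩
  have hshort (u : ℤˣ) (a : Fin (n + 1)) : ∃ m : ℤ, ⟪u • eps e a, x⟫ = m := by
    obtain ⟨m, hm⟩ := hx a
    rw [coord_apply] at hm
    refine ⟨u * m, ?_⟩
    rcases Int.units_eq_one_or u with rfl | rfl <;> simp [hm]
  refine ⟨hshort, fun u v a c _ => ?_⟩
  obtain ⟨m, hm⟩ := hshort u a
  obtain ⟨m', hm'⟩ := hshort v c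
  exact ⟨m + m', by rw [inner_add_left, hm, hm', Int.cast_add]⟩

variable [P.IsRootSystem]

theorem coord_injective (e : Fin (n + 1) ≃ b.support) : Function.Injective (coord e) :=
  fun x y hxy => InnerProductSpace.ext_inner_left_basis (𝕜 := ℝ) (epsBasis e) fun k => by
    rw [epsBasis_apply]
    exact congrFun hxy k

theorem coord_surjective (e : Fin (n + 1) ≃ b.support) : Function.Surjective (coord e) := by
  have : FiniteDimensional ℝ E := (epsBasis e).finiteDimensional_of_finite
  refine (LinearMap.injective_iff_surjective_of_finrank_eq_finrank ?_).1 (coord_injective e)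
  rw [Module.finrank_eq_card_basis (epsBasis e), Module.finrank_pi]

end Coord

section StandardAlcove

variable {n : ℕ}

/-- The fundamental alcove of type `B` in coordinates. -/
def standardAlcove (n : ℕ) : Set (Fin (n + 2) → ℝ) :=
  {c | StrictAnti c ∧ (∀ k, 0 < c k) ∧ c 0 + c 1 < 1}

variable {c d : Fin (n + 2) → ℝ}

theorem lt_half_of_mem_standardAlcove (hc : c ∈ standardAlcove n) {k : Fin (n + 2)}
    (hk : k ≠ 0) : c k < 1 / 2 := by
  obtain ⟨hanti, -, hsum⟩ := hc
  linarith [hanti.antitone (Fin.one_le_of_ne_zero hk), hanti (Fin.zero_lt_one (n := n))]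

theorem lt_one_of_mem_standardAlcove (hc : c ∈ standardAlcove n) (k : Fin (n + 2)) : c k < 1 := by
  obtain ⟨hanti, hpos, hsum⟩ := hc
  linarith [hanti.antitone (Fin.zero_le k), hpos 1]

theorem update_one_sub_mem_standardAlcove (hc : c ∈ standardAlcove n) :
    Function.update c 0 (1 - c 0) ∈ standardAlcove n := by
  have hc' := hc
  obtain ⟨hanti, hpos, hsum⟩ := hc'
  have hlt := hanti (Fin.zero_lt_one (n := n))
  refine ⟨Fin.strictAnti_iff_succ_lt.2 fun j => ?_, fun k => ?_, ?_⟩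
  · rw [Function.update_of_ne (Fin.succ_ne_zero j)]
    rcases eq_or_ne j 0 with rfl | hj
    · rw [Fin.castSucc_zero, Function.update_self]
      exact lt_sub_iff_add_lt'.2 hsum
    · rw [Function.update_of_ne (Fin.castSucc_ne_zero_iff.2 hj)]
      exact hanti Fin.castSucc_lt_succ
  · rcases eq_or_ne k 0 with rfl | hk
    · rw [Function.update_self]
      exact sub_pos.2 (lt_one_of_mem_standardAlcove hc 0)
    · rw [Function.update_of_ne hk]
      exact hpos k
  · rw [Function.update_self, Function.update_of_ne Fin.zero_ne_one.symm]
    linarith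

theorem exists_mem_standardAlcove_forall_lt_half (n : ℕ) :
    ∃ c ∈ standardAlcove n, ∀ k, c k < 1 / 2 := by
  have hn : (0 : ℝ) < 2 * (n + 3) := by positivity
  have hlt (k : Fin (n + 2)) : ((n : ℝ) + 2 - k) / (2 * (n + 3)) < 1 / 2 := by
    rw [div_lt_iff₀ hn]
    linarith [((k : ℕ).cast_nonneg : (0 : ℝ) ≤ (k : ℕ))]
  refine ⟨fun k => ((n : ℝ) + 2 - k) / (2 * (n + 3)), ⟨fun j k hjk => ?_, fun k => ?_, ?_⟩, hlt⟩
  · have hjk' : ((j : ℕ) : ℝ) < (k : ℕ) := by exact_mod_cast hjk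
    exact div_lt_div_of_pos_right (by linarith) hn
  · have hk : ((k : ℕ) : ℝ) < n + 2 := by exact_mod_cast k.2
    exact div_pos (by linarith) hn
  · linarith [hlt 0, hlt 1]

theorem eq_or_eq_one_sub_of_mem_standardAlcove (hc : c ∈ standardAlcove n)
    {x : ℝ} (hx₀ : 0 < x) (hx₁ : x < 1 / 2) (u : ℤˣ) {k : Fin (n + 2)}
    (hint : ∃ m : ℤ, x - u • c k = m) :
    u = 1 ∧ x = c k ∨ u = -1 ∧ k = 0 ∧ x = 1 - c k := by
  obtain ⟨m, hm⟩ := hint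
  have hck₀ := hc.2.1 k
  have hck₁ := lt_one_of_mem_standardAlcove hc k
  rcases Int.units_eq_one_or u with rfl | rfl
  · rw [one_smul] at hm
    have hm₀ : m = 0 := by
      have hm_lt : (m : ℝ) < 1 := by linarith
      have lt_hm : (-1 : ℝ) < m := by linarith
      norm_cast at hm_lt lt_hm
      omega
    rw [hm₀, Int.cast_zero, sub_eq_zero] at hm
    exact .inl ⟨rfl, hm⟩
  · rw [Units.neg_smul, one_smul, sub_neg_eq_add] at hm
    have hm₁ : m = 1 := by
      have hm_lt : (m : ℝ) < 2 := by linarith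
      have lt_hm : (0 : ℝ) < m := by linarith
      norm_cast at hm_lt lt_hm
      omega
    rw [hm₁, Int.cast_one] at hm
    refine .inr ⟨rfl, ?_, by linarith⟩
    by_contra hk
    linarith [lt_half_of_mem_standardAlcove hc hk]

/- Up to reordering, `d` is either `c` or its flip `update c 0 (1 - c 0)`. Both are decreasing, so
nothing is permuted. -/
theorem eq_one_or_eq_mulSingle_of_mem_standardAlcove (hc : c ∈ standardAlcove n)
    (hd : d ∈ standardAlcove n) (hd_lt : ∀ k, d k < 1 / 2) {σ : Equiv.Perm (Fin (n + 2))}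
    {s : Fin (n + 2) → ℤˣ} (hint : ∀ k, ∃ m : ℤ, d (σ k) - s k • c k = m) :
    σ = 1 ∧ (s = 1 ∨ s = Pi.mulSingle 0 (-1)) := by
  have hcases (k) :=
    eq_or_eq_one_sub_of_mem_standardAlcove hc (hd.2.1 (σ k)) (hd_lt (σ k)) (s k) (hint k)
  have hother {k} (hk : k ≠ 0) : s k = 1 ∧ d (σ k) = c k :=
    (hcases k).resolve_right fun hflip => hk hflip.2.1
  have perm_eq_one (hanti : StrictAnti (d ∘ σ)) : σ = 1 :=
    perm_eq_one_of_lt_succ fun j => hd.1.lt_iff_gt.1 (hanti Fin.castSucc_lt_succ)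
  rcases hcases 0 with ⟨hs, hd₀⟩ | ⟨hs, -, hd₀⟩
  · have comp_eq : d ∘ σ = c := funext fun k => by
      rcases eq_or_ne k 0 with rfl | hk
      exacts [hd₀, (hother hk).2]
    refine ⟨perm_eq_one (comp_eq ▸ hc.1), .inl (funext fun k => ?_)⟩
    rcases eq_or_ne k 0 with rfl | hk
    exacts [hs, (hother hk).1]
  · have comp_eq : d ∘ σ = Function.update c 0 (1 - c 0) :=
      Function.eq_update_iff.2 ⟨hd₀, fun k hk => (hother hk).2⟩
    refine ⟨perm_eq_one (comp_eq ▸ (update_one_sub_mem_standardAlcove hc).1), .inr ?_⟩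
    exact Function.eq_update_iff.2 ⟨hs, fun k hk => (hother hk).1⟩

end StandardAlcove

section AlcoveImage

variable {ι E N : Type*} [NormedAddCommGroup E] [InnerProductSpace ℝ E] [AddCommGroup N]
  [Module ℝ N] {P : RootPairing ι ℝ E N} [P.IsRootSystem] {b : P.Base}

theorem eq_of_mem_parallelepiped {x y : E} (hx : x ∈ parallelepiped b)
    (hy : y ∈ parallelepiped b) (hxy : x - y ∈ coweightLattice P) : x = y := by
  refine InnerProductSpace.ext_inner_left_basis (𝕜 := ℝ) b.toWeightBasis fun i => ?_
  rw [b.toWeightBasis_apply]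
  obtain ⟨m, hm⟩ := hxy i
  obtain ⟨hx₀, hx₁⟩ := hx i i.2
  obtain ⟨hy₀, hy₁⟩ := hy i i.2
  rw [inner_sub_right] at hm
  have hm₀ : m = 0 := by
    have hm_lt : (m : ℝ) < 1 := by linarith
    have lt_hm : (-1 : ℝ) < m := by linarith
    norm_cast at hm_lt lt_hm
    omega
  rwa [hm₀, Int.cast_zero, sub_eq_zero] at hm

theorem alcoveImage_eq_image {w : P.weylGroup} {C : Set E} {f : E → E}
    (hf : Set.MapsTo f C (parallelepiped b)) (hfw : ∀ x ∈ C, f x - w • x ∈ coweightLattice P) :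
    alcoveImage b w C = f '' C := by
  ext y
  constructor
  · rintro ⟨hy, x, hx, hyx⟩
    refine ⟨x, hx, eq_of_mem_parallelepiped (hf hx) hy ?_⟩
    simpa using sub_mem (hfw x hx) hyx
  · rintro ⟨x, hx, rfl⟩
    exact ⟨hf hx, x, hx, hfw x hx⟩

end AlcoveImage

section Stabilizer

variable {ι E N : Type*} [Finite ι] [NormedAddCommGroup E] [InnerProductSpace ℝ E]
  [AddCommGroup N] [Module ℝ N] {P : RootPairing ι ℝ E N} [P.IsCrystallographic] [P.IsReduced]
  [P.IsRootSystem] {b : P.Base} {n : ℕ} {e : Fin (n + 2) ≃ b.support}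

theorem IsTypeB.mem_fundamentalAlcove_iff (h : IsTypeB e) {x : E} :
    x ∈ fundamentalAlcove b ↔ coord e x ∈ standardAlcove n := by
  obtain ⟨i, hi⟩ := h.exists_root_eq_smul_eps_add 1 1 (Fin.zero_ne_one (n := n))
  rw [one_smul, one_smul] at hi
  have highest : (∀ k, IsHighestRoot b k → ⟪P.root k, x⟫ < 1) ↔ coord e x 0 + coord e x 1 < 1 := by
    simp only [h.isHighestRoot_iff, coord_apply, ← inner_add_left, ← hi]
    exact ⟨fun hx => hx i rfl, fun hx k hk => hk ▸ hx⟩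
  rw [fundamentalAlcove, Set.mem_ofPred_eq, forall_inner_root_pos_iff e, highest, and_assoc]
  rfl

theorem IsTypeB.fundamentalAlcove_subset_parallelepiped (h : IsTypeB e) :
    fundamentalAlcove b ⊆ parallelepiped b := by
  intro x hx i hi
  refine ⟨hx.1 i hi, ?_⟩
  have hcoord := h.mem_fundamentalAlcove_iff.1 hx
  obtain ⟨k, hk⟩ := e.surjective ⟨i, hi⟩
  obtain rfl : (e k : ι) = i := congrArg Subtype.val hk
  induction k using Fin.lastCases with
  | last => exact inner_root_last e x ▸ (lt_one_of_mem_standardAlcove hcoord _).le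
  | cast j =>
    rw [inner_root_castSucc]
    linarith [lt_one_of_mem_standardAlcove hcoord j.castSucc, hcoord.2.1 j.succ]

theorem IsTypeB.one_mem_alcoveStabilizer (h : IsTypeB e) : 1 ∈ alcoveStabilizer b := by
  refine (alcoveImage_eq_image (f := id) h.fundamentalAlcove_subset_parallelepiped ?_).trans
    (Set.image_id _)
  intro x _
  rw [id, one_smul, sub_self]
  exact zero_mem _

variable [IsEuclidean P]

theorem IsTypeB.coord_omega_smul (h : IsTypeB e) (x : E) :
    coord e (omega b (e 0) • x) = Function.update (coord e x) 0 (-coord e x 0) :=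
  Function.eq_update_iff.2 ⟨by simpa using h.actsBy_omega.coord_smul x 0,
    fun k hk => by simpa [hk] using h.actsBy_omega.coord_smul x k⟩

theorem IsTypeB.omega_mem_alcoveStabilizer (h : IsTypeB e) :
    omega b (e 0) ∈ alcoveStabilizer b := by
  choose f hf using fun x => coord_surjective e (Function.update (coord e x) 0 (1 - coord e x 0))
  have mapsTo : Set.MapsTo f (fundamentalAlcove b) (fundamentalAlcove b) := fun x hx => by
    rw [h.mem_fundamentalAlcove_iff, hf]
    exact update_one_sub_mem_standardAlcove (h.mem_fundamentalAlcove_iff.1 hx)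
  have involutive : Function.Involutive f := fun x => coord_injective e <| by
    simp only [hf, Function.update_self, Function.update_idem, sub_sub_cancel,
      Function.update_eq_self]
  have sub_mem (x : E) : f x - omega b (e 0) • x ∈ coweightLattice P := by
    refine h.mem_coweightLattice_iff.2 fun k => ⟨if k = 0 then 1 else 0, ?_⟩
    rw [map_sub, hf, h.coord_omega_smul]
    rcases eq_or_ne k 0 with rfl | hk
    · simp
    · simp [hk]
  refine (alcoveImage_eq_image (mapsTo.mono_right h.fundamentalAlcove_subset_parallelepiped)
    fun x _ => sub_mem x).trans ?_
  exact mapsTo.image_subset.antisymm fun x hx => ⟨f x, mapsTo hx, involutive x⟩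

theorem IsTypeB.eq_one_or_eq_omega_of_mem_alcoveStabilizer (h : IsTypeB e) {w : P.weylGroup}
    (hw : w ∈ alcoveStabilizer b) : w = 1 ∨ w = omega b (e 0) := by
  obtain ⟨d, hd, hd_lt⟩ := exists_mem_standardAlcove_forall_lt_half n
  obtain ⟨y, rfl⟩ := coord_surjective e d
  obtain ⟨-, x, hx, hyx⟩ := (Set.ext_iff.1 hw y).2 (h.mem_fundamentalAlcove_iff.2 hd)
  obtain ⟨σ, s, hσ⟩ := h.exists_actsBy w
  have hint (k) : ∃ m : ℤ, coord e y (σ k) - s k • coord e x k = m := by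
    simpa only [map_sub, Pi.sub_apply, hσ.coord_smul] using h.mem_coweightLattice_iff.1 hyx (σ k)
  obtain ⟨rfl, rfl | rfl⟩ := eq_one_or_eq_mulSingle_of_mem_standardAlcove
    (h.mem_fundamentalAlcove_iff.1 hx) hd hd_lt hint
  · exact .inl (hσ.eq actsBy_one)
  · exact .inr (hσ.eq h.actsBy_omega)

theorem IsTypeB.alcoveStabilizer_eq (h : IsTypeB e) :
    alcoveStabilizer b = {1, omega b (e 0)} := by
  refine Set.Subset.antisymm (fun w hw => h.eq_one_or_eq_omega_of_mem_alcoveStabilizer hw) ?_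
  rintro w (rfl | rfl)
  exacts [h.one_mem_alcoveStabilizer, h.omega_mem_alcoveStabilizer]

end Stabilizer

section Regular

variable {X κ : Type*} [AddCommGroup X]

/-- The points of `X ^ κ` off the toric hyperplanes `x_i = ±x_j` with `i ≠ j`. -/
def SignSeparated (v : κ → X) : Prop := Pairwise fun i j => ∀ u : ℤˣ, v i ≠ u • v j

/-- The points of `X ^ κ` off all hyperplanes `x_i = 0` and `x_i = ±x_j` of the arrangement. -/
def IsRegular (v : κ → X) : Prop := (∀ i, v i ≠ 0) ∧ SignSeparated v

/-- The points of `X ^ κ` off the hypersurfaces `2 x_i = 0` and `x_i = ±x_j`. -/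
def IsStrictlyRegular (v : κ → X) : Prop := (∀ i, v i ≠ -v i) ∧ SignSeparated v

theorem isRegular_iff_units_smul_ne_zero {v : κ → X} :
    IsRegular v ↔ (∀ (u : ℤˣ) i, u • v i ≠ 0) ∧
      ∀ (u w : ℤˣ) i j, i ≠ j → u • v i + w • v j ≠ 0 := by
  have smul_add_smul (u w : ℤˣ) (x y : X) : u • x + w • y = 0 ↔ x = -(u * w) • y := by
    rw [add_eq_zero_iff_eq_neg, ← smul_left_cancel_iff u, smul_smul, Int.units_mul_self, one_smul,
      smul_neg, smul_smul, Units.neg_smul]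
  simp only [IsRegular, SignSeparated, Pairwise, ne_eq, smul_eq_zero_iff_eq, smul_add_smul,
    forall_const]
  refine and_congr_right fun _ => ⟨fun hv u w i j hij => hv hij _, fun hv i j hij u huv => ?_⟩
  exact hv (-u) 1 i j hij (by rwa [mul_one, neg_neg])

theorem IsStrictlyRegular.isRegular {v : κ → X} (hv : IsStrictlyRegular v) : IsRegular v :=
  ⟨fun i hi => hv.1 i (by rw [hi, neg_zero]), hv.2⟩

theorem isRegular_iff_isStrictlyRegular (hX : ∀ x : X, x = -x → x = 0) {v : κ → X} :
    IsRegular v ↔ IsStrictlyRegular v :=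
  ⟨fun hv => ⟨fun i hi => hv.1 i (hX _ hi), hv.2⟩, IsStrictlyRegular.isRegular⟩

theorem IsStrictlyRegular.injective_units_smul {v : κ → X} (hv : IsStrictlyRegular v) :
    Function.Injective fun p : ℤˣ × κ => p.1 • v p.2 := by
  rintro ⟨u, i⟩ ⟨u', j⟩ huv
  replace huv : v i = (u * u') • v j := by
    rw [mul_smul, ← show u • v i = u' • v j from huv, smul_smul, Int.units_mul_self, one_smul]
  obtain rfl : i = j := by
    by_contra hij
    exact hv.2 hij _ huv
  rcases Int.units_eq_one_or (u * u') with hu | hu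
  · rw [mul_eq_one_iff_eq_inv, Int.units_inv_eq_self] at hu
    rw [hu]
  · rw [hu, Units.neg_smul, one_smul] at huv
    exact absurd huv (hv.1 i)

variable {n : ℕ} {v : Fin n → X} {x : X}

theorem signSeparated_insertNth_iff (i : Fin (n + 1)) :
    SignSeparated (i.insertNth x v : Fin (n + 1) → X) ↔
      SignSeparated v ∧ ∀ (u : ℤˣ) j, x ≠ u • v j := by
  have smul_ne (hx : ∀ (u : ℤˣ) j, x ≠ u • v j) (u : ℤˣ) (j : Fin n) : v j ≠ u • x := fun hj =>
    hx u j (by rw [hj, smul_smul, Int.units_mul_self, one_smul])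
  simp only [SignSeparated, Pairwise, Fin.forall_iff_succAbove i, Fin.insertNth_apply_same,
    Fin.insertNth_apply_succAbove, ne_eq, not_true_eq_false, false_imp_iff, true_and,
    Fin.succAbove_right_inj, Fin.succAbove_ne, (Fin.succAbove_ne _ _).symm, not_false_eq_true,
    true_imp_iff]
  exact ⟨fun hv => ⟨fun j k => (hv.2 j).2 k, fun u j => hv.1 j u⟩,
    fun hv => ⟨fun j u => hv.2 u j, fun j => ⟨fun u => smul_ne hv.2 u j, fun _ hjk => hv.1 hjk⟩⟩⟩

theorem isStrictlyRegular_insertNth_iff (i : Fin (n + 1)) :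
    IsStrictlyRegular (i.insertNth x v : Fin (n + 1) → X) ↔
      IsStrictlyRegular v ∧ x ≠ -x ∧ ∀ (u : ℤˣ) j, x ≠ u • v j := by
  simp only [IsStrictlyRegular, signSeparated_insertNth_iff, Fin.forall_iff_succAbove i,
    Fin.insertNth_apply_same, Fin.insertNth_apply_succAbove]
  tauto

theorem isRegular_insertNth_iff {t : X} (ht : t ≠ 0) (hX : ∀ x : X, x = -x ↔ x = 0 ∨ x = t)
    (i : Fin (n + 1)) :
    IsRegular (i.insertNth t v : Fin (n + 1) → X) ↔ IsStrictlyRegular v := by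
  have ht' : -t = t := ((hX t).2 (.inr rfl)).symm
  have ne_smul_iff (j : Fin n) : (∀ u : ℤˣ, t ≠ u • v j) ↔ v j ≠ t := by
    refine ⟨fun hj hjt => hj 1 (by rw [hjt, one_smul]), fun hj u hjt => hj ?_⟩
    rcases Int.units_eq_one_or u with rfl | rfl
    · rw [hjt, one_smul]
    · rw [← ht', hjt, Units.neg_smul, one_smul, neg_neg]
  rw [IsRegular, signSeparated_insertNth_iff, forall_comm, forall_congr' ne_smul_iff,
    IsStrictlyRegular]
  simp only [Fin.forall_iff_succAbove i, Fin.insertNth_apply_same, Fin.insertNth_apply_succAbove,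
    ne_eq, hX, not_or, forall_and, ht, not_false_eq_true, true_and]
  tauto

theorem ncard_isRegular_self_eq_neg {t : X} (ht : t ≠ 0) (hX : ∀ x : X, x = -x ↔ x = 0 ∨ x = t)
    (i : Fin (n + 1)) : {v : Fin (n + 1) → X | IsRegular v ∧ v i = -v i}.ncard =
      Nat.card {v : Fin n → X // IsStrictlyRegular v} := by
  have eq_image : {v : Fin (n + 1) → X | IsRegular v ∧ v i = -v i} =
      (i.insertNth t · : (Fin n → X) → Fin (n + 1) → X) '' {v | IsStrictlyRegular v} := by
    ext v
    constructor
    · rintro ⟨hv, hvi⟩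
      obtain rfl : v i = t := ((hX _).1 hvi).resolve_left (hv.1 i)
      refine ⟨i.removeNth v, ?_, Fin.insertNth_self_removeNth i v⟩
      rw [Set.mem_ofPred_eq, ← isRegular_insertNth_iff ht hX i, Fin.insertNth_self_removeNth]
      exact hv
    · rintro ⟨v, hv, rfl⟩
      refine ⟨(isRegular_insertNth_iff ht hX i).2 hv, ?_⟩
      simpa only [Fin.insertNth_apply_same] using (hX t).2 (.inr rfl)
  rw [eq_image]
  exact (Set.ncard_image_of_injective _ (Fin.insertNth_right_injective (α := fun _ => X) t)).trans
    (Nat.card_coe_set_eq _).symm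

end Regular

section Counting

variable {X : Type*} [AddCommGroup X] {n : ℕ}

def isStrictlyRegularSuccEquiv (X : Type*) [AddCommGroup X] (n : ℕ) :
    {w : Fin (n + 1) → X // IsStrictlyRegular w} ≃
      Σ v : {v : Fin n → X // IsStrictlyRegular v},
        {x : X // x ≠ -x ∧ ∀ (u : ℤˣ) j, x ≠ u • v.1 j} where
  toFun w :=
    have hw : IsStrictlyRegular (Fin.insertNth 0 (w.1 0) (Fin.tail w.1) : Fin (n + 1) → X) := by
      rw [Fin.insertNth_zero', Fin.cons_self_tail]
      exact w.2
    ⟨⟨Fin.tail w.1, ((isStrictlyRegular_insertNth_iff 0).1 hw).1⟩,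
      ⟨w.1 0, ((isStrictlyRegular_insertNth_iff 0).1 hw).2⟩⟩
  invFun p := ⟨Fin.insertNth 0 p.2.1 p.1.1, (isStrictlyRegular_insertNth_iff 0).2 ⟨p.1.2, p.2.2⟩⟩
  left_inv w := Subtype.ext (by simp)
  right_inv _ := rfl

variable [Finite X]

theorem card_extensions_add {v : Fin n → X} (hv : IsStrictlyRegular v) :
    Nat.card {x : X // x ≠ -x ∧ ∀ (u : ℤˣ) j, x ≠ u • v j} + 2 * n =
      {x : X | x ≠ -x}.ncard := by
  have range_subset : Set.range (fun p : ℤˣ × Fin n => p.1 • v p.2) ⊆ {x : X | x ≠ -x} := by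
    rintro _ ⟨⟨u, i⟩, rfl⟩
    exact fun hi => hv.1 i (smul_left_cancel u (by rwa [smul_neg]))
  have ncard_range : (Set.range fun p : ℤˣ × Fin n => p.1 • v p.2).ncard = 2 * n := by
    rw [← Set.image_univ, Set.ncard_image_of_injective _ hv.injective_units_smul, Set.ncard_univ]
    simp
  rw [← Set.ncard_sdiff_add_ncard_of_subset range_subset, ncard_range, ← Nat.card_coe_set_eq]
  congr 1
  refine Nat.card_congr (Equiv.subtypeEquivRight fun x => and_congr_right fun _ => ?_)
  simp [eq_comm]

theorem card_isStrictlyRegular (X : Type*) [AddCommGroup X] [Finite X] (n : ℕ) :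
    (Nat.card {v : Fin n → X // IsStrictlyRegular v} : ℤ) =
      ∏ i ∈ Finset.Icc 1 n, (({x : X | x ≠ -x}.ncard : ℤ) - 2 * (i - 1)) := by
  induction n with
  | zero => simp [IsStrictlyRegular, SignSeparated, Pairwise]
  | succ n ih =>
    cases nonempty_fintype {v : Fin n → X // IsStrictlyRegular v}
    rw [Finset.prod_Icc_succ_top (by omega), ← ih, Nat.card_congr (isStrictlyRegularSuccEquiv X n),
      Nat.card_sigma, Nat.cast_sum, Nat.card_eq_fintype_card, ← nsmul_eq_mul, ← Finset.card_univ]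
    refine Finset.sum_eq_card_nsmul fun v _ => ?_
    rw [← card_extensions_add v.2]
    push_cast
    ring

/- Two coordinates of a regular point differ, so at most one of them is the involution `t`. -/
theorem card_isRegular_succ {t : X} (ht : t ≠ 0) (hX : ∀ x : X, x = -x ↔ x = 0 ∨ x = t) :
    Nat.card {v : Fin (n + 1) → X // IsRegular v} =
      Nat.card {v : Fin (n + 1) → X // IsStrictlyRegular v} +
        (n + 1) * Nat.card {v : Fin n → X // IsStrictlyRegular v} := by
  have eq_union : {v : Fin (n + 1) → X | IsRegular v} = {v | IsStrictlyRegular v} ∪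
      ⋃ i, {v | IsRegular v ∧ v i = -v i} := by
    ext v
    simp only [Set.mem_union, Set.mem_ofPred_eq, Set.mem_iUnion, exists_and_left]
    refine ⟨fun hv => ?_, fun hv => hv.elim IsStrictlyRegular.isRegular And.left⟩
    by_cases hinv : ∃ i, v i = -v i
    · exact .inr ⟨hv, hinv⟩
    · exact .inl ⟨not_exists.1 hinv, hv.2⟩
  have disjoint : Disjoint {v : Fin (n + 1) → X | IsStrictlyRegular v}
      (⋃ i, {v | IsRegular v ∧ v i = -v i}) :=
    Set.disjoint_iUnion_right.2 fun i => Set.disjoint_left.2 fun v hv hvi => hv.1 i hvi.2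
  have pairwise_disjoint : Pairwise
      (Function.onFun Disjoint fun i => {v : Fin (n + 1) → X | IsRegular v ∧ v i = -v i}) := by
    refine fun i j hij => Set.disjoint_left.2 fun v hvi hvj => hvi.1.2 hij 1 ?_
    have eq_t {k} (hk : v k = -v k) : v k = t := ((hX _).1 hk).resolve_left (hvi.1.1 k)
    rw [one_smul, eq_t hvi.2, eq_t hvj.2]
  have ncard_iUnion : (⋃ i, {v : Fin (n + 1) → X | IsRegular v ∧ v i = -v i}).ncard =
      (n + 1) * Nat.card {v : Fin n → X // IsStrictlyRegular v} := by
    rw [Set.ncard_iUnion_of_finite (fun _ => Set.toFinite _) pairwise_disjoint,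
      finsum_eq_sum_of_fintype]
    simp [ncard_isRegular_self_eq_neg ht hX]
  rw [← ncard_iUnion, ← Set.coe_ofPred, ← Set.coe_ofPred, Nat.card_coe_set_eq,
    Nat.card_coe_set_eq, eq_union, Set.ncard_union_eq disjoint]

end Counting

section ZMod

variable {q : ℕ}

theorem zmod_eq_neg_iff_of_odd (hq : Odd q) (x : ZMod q) : x = -x ↔ x = 0 := by
  rw [eq_comm, ZMod.neg_eq_self_iff, or_iff_left]
  rintro hx
  exact Nat.not_even_iff_odd.2 hq ⟨x.val, by omega⟩

theorem ncard_isRegular_zmod_self_eq_neg_of_odd (hq : Odd q) {κ : Type*} (i : κ) :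
    {v : κ → ZMod q | IsRegular v ∧ v i = -v i}.ncard = 0 := by
  have eq_empty : {v : κ → ZMod q | IsRegular v ∧ v i = -v i} = ∅ :=
    Set.eq_empty_of_forall_notMem fun v hv =>
      hv.1.1 i ((zmod_eq_neg_iff_of_odd hq _).1 hv.2)
  rw [eq_empty, Set.ncard_empty]

variable [NeZero q]

theorem exists_zmod_eq_neg_iff_of_even (hq : Even q) :
    ∃ t : ZMod q, t ≠ 0 ∧ ∀ x : ZMod q, x = -x ↔ x = 0 ∨ x = t := by
  obtain ⟨k, hk⟩ := hq
  have q_pos := NeZero.pos q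
  have val_k : (k : ZMod q).val = k := ZMod.val_cast_of_lt (by omega)
  refine ⟨k, fun k_eq_zero => ?_, fun x => ?_⟩
  · rw [k_eq_zero, ZMod.val_zero] at val_k
    omega
  · rw [eq_comm, ZMod.neg_eq_self_iff]
    refine or_congr_right ⟨fun hx => ZMod.val_injective q (by omega), ?_⟩
    rintro rfl
    omega

theorem ncard_zmod_ne_neg_of_odd (hq : Odd q) : {x : ZMod q | x ≠ -x}.ncard = (q : ℤ) - 1 := by
  have eq_compl : {x : ZMod q | x ≠ -x} = {0}ᶜ :=
    Set.ext fun x => not_congr (zmod_eq_neg_iff_of_odd hq x)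
  rw [eq_compl, Set.ncard_compl, Nat.card_zmod, Set.ncard_singleton,
    Nat.cast_pred (NeZero.pos q)]

theorem ncard_zmod_ne_neg_of_even (hq : Even q) : {x : ZMod q | x ≠ -x}.ncard = (q : ℤ) - 2 := by
  obtain ⟨t, ht, hX⟩ := exists_zmod_eq_neg_iff_of_even hq
  have eq_compl : {x : ZMod q | x ≠ -x} = {0, t}ᶜ := Set.ext fun x => not_congr (hX x)
  have card_add := Set.ncard_add_ncard_compl ({0, t} : Set (ZMod q))
  rw [Set.ncard_pair ht.symm, Nat.card_zmod] at card_add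
  rw [eq_compl, eq_sub_iff_add_eq']
  exact_mod_cast card_add

theorem card_isRegular_zmod_of_odd (hq : Odd q) (n : ℕ) :
    (Nat.card {v : Fin n → ZMod q // IsRegular v} : ℤ) =
      ∏ i ∈ Finset.Icc 1 n, ((q : ℤ) - (2 * i - 1)) := by
  simp only [isRegular_iff_isStrictlyRegular fun x => (zmod_eq_neg_iff_of_odd hq x).1]
  rw [card_isStrictlyRegular, ncard_zmod_ne_neg_of_odd hq]
  exact Finset.prod_congr rfl fun i _ => by ring

theorem card_isStrictlyRegular_zmod_of_even (hq : Even q) (n : ℕ) :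
    (Nat.card {v : Fin n → ZMod q // IsStrictlyRegular v} : ℤ) =
      ∏ i ∈ Finset.Icc 1 n, ((q : ℤ) - 2 * i) := by
  rw [card_isStrictlyRegular, ncard_zmod_ne_neg_of_even hq]
  exact Finset.prod_congr rfl fun i _ => by ring

theorem card_isRegular_zmod_of_even (hq : Even q) (n : ℕ) :
    (Nat.card {v : Fin (n + 1) → ZMod q // IsRegular v} : ℤ) =
      (∏ i ∈ Finset.Icc 1 n, ((q : ℤ) - 2 * i)) * (q - (n + 1 : ℕ)) := by
  obtain ⟨t, ht, hX⟩ := exists_zmod_eq_neg_iff_of_even hq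
  rw [card_isRegular_succ ht hX, Nat.cast_add, Nat.cast_mul,
    card_isStrictlyRegular_zmod_of_even hq, card_isStrictlyRegular_zmod_of_even hq,
    Finset.prod_Icc_succ_top (by omega)]
  push_cast
  ring

theorem ncard_isRegular_zmod_self_eq_neg_of_even (hq : Even q) {n : ℕ} (i : Fin (n + 1)) :
    ({v : Fin (n + 1) → ZMod q | IsRegular v ∧ v i = -v i}.ncard : ℤ) =
      ∏ i ∈ Finset.Icc 1 n, ((q : ℤ) - 2 * i) := by
  obtain ⟨t, ht, hX⟩ := exists_zmod_eq_neg_iff_of_even hq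
  rw [ncard_isRegular_self_eq_neg ht hX, card_isStrictlyRegular_zmod_of_even hq]

end ZMod

section Reduction

variable {ι E N : Type*} [Finite ι] [NormedAddCommGroup E] [InnerProductSpace ℝ E]
  [AddCommGroup N] [Module ℝ N] {P : RootPairing ι ℝ E N} [P.IsCrystallographic] [P.IsReduced]
  {b : P.Base} {n : ℕ} {e : Fin (n + 1) ≃ b.support}

/-- The coordinates `(ε_k, x)` of a point `x` of the coweight lattice in type `B`, as integers. -/
noncomputable def intCoord (h : IsTypeB e) : coweightLattice P →+ (Fin (n + 1) → ℤ) :=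
  AddMonoidHom.mk' (fun x k => ⌊coord e x k⌋) fun x y => by
    ext k
    obtain ⟨m, hm⟩ := h.mem_coweightLattice_iff.1 x.2 k
    rw [AddSubgroup.coe_add, map_add, Pi.add_apply, Pi.add_apply, hm, Int.floor_intCast_add,
      Int.floor_intCast]

theorem coe_intCoord (h : IsTypeB e) (x : coweightLattice P) (k : Fin (n + 1)) :
    (intCoord h x k : ℝ) = coord e x k := by
  obtain ⟨m, hm⟩ := h.mem_coweightLattice_iff.1 x.2 k
  rw [intCoord, AddMonoidHom.mk'_apply, hm, Int.floor_intCast]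

/-- The coordinates of a point of the coweight lattice modulo `q`. -/
noncomputable def modCoord (h : IsTypeB e) (q : ℕ) :
    coweightLattice P →+ (Fin (n + 1) → ZMod q) :=
  ((Int.castAddHom (ZMod q)).compLeft _).comp (intCoord h)

theorem modCoord_apply (h : IsTypeB e) (q : ℕ) (x : coweightLattice P) (k : Fin (n + 1)) :
    modCoord h q x k = (intCoord h x k : ZMod q) := rfl

theorem isRegular_modCoord_iff (h : IsTypeB e) (q : ℕ) (x : coweightLattice P) :
    IsRegular (modCoord h q x) ↔ ∀ i, ¬ ∃ k : ℤ, ⟪P.root i, (x : E)⟫ = (q : ℝ) * k := by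
  have dvd_iff (y : E) (m : ℤ) (hm : ⟪y, (x : E)⟫ = m) :
      (∃ k : ℤ, ⟪y, (x : E)⟫ = (q : ℝ) * k) ↔ (m : ZMod q) = 0 := by
    rw [ZMod.intCast_zmod_eq_zero_iff_dvd, dvd_def, hm]
    exact exists_congr fun k => by exact_mod_cast Iff.rfl
  have inner_smul_eps (u : ℤˣ) (a : Fin (n + 1)) :
      ⟪u • eps e a, (x : E)⟫ = (u • intCoord h x a : ℤ) := by
    rcases Int.units_eq_one_or u with rfl | rfl <;> simp [coe_intCoord]
  have cast_smul (u : ℤˣ) (a : Fin (n + 1)) :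
      ((u • intCoord h x a : ℤ) : ZMod q) = u • modCoord h q x a := by
    rw [modCoord_apply, Units.smul_def, Units.smul_def, smul_eq_mul, Int.cast_mul, zsmul_eq_mul]
  rw [h.forall_root_iff (p := fun y => ¬ ∃ k : ℤ, ⟪y, (x : E)⟫ = (q : ℝ) * k),
    isRegular_iff_units_smul_ne_zero]
  refine and_congr (forall₂_congr fun u a => not_congr ?_)
    (forall₅_congr fun u v a c _ => not_congr ?_)
  · rw [dvd_iff _ _ (inner_smul_eps u a), cast_smul]
  · rw [dvd_iff _ (u • intCoord h x a + v • intCoord h x c)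
      (by rw [inner_add_left, inner_smul_eps, inner_smul_eps, Int.cast_add]),
      Int.cast_add, cast_smul, cast_smul]

theorem ActsBy.modCoord_latticeAction [IsEuclidean P] {w : P.weylGroup}
    {σ : Equiv.Perm (Fin (n + 1))} {s : Fin (n + 1) → ℤˣ} (hw : ActsBy e w σ s) (h : IsTypeB e)
    (q : ℕ) (x : coweightLattice P) (k : Fin (n + 1)) :
    modCoord h q (latticeAction P w x) (σ k) = s k • modCoord h q x k := by
  have intCoord_eq : intCoord h (latticeAction P w x) (σ k) = s k * intCoord h x k := by
    rw [← @Int.cast_inj ℝ, Int.cast_mul, coe_intCoord, coe_intCoord, ← zsmul_eq_mul,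
      ← Units.smul_def]
    exact hw.coord_smul x k
  rw [modCoord_apply, intCoord_eq, Int.cast_mul, ← zsmul_eq_mul, ← Units.smul_def, modCoord_apply]

variable [P.IsRootSystem]

theorem intCoord_injective (h : IsTypeB e) : Function.Injective (intCoord h) := fun x y hxy =>
  Subtype.ext <| coord_injective e <| funext fun k => by
    rw [← coe_intCoord h, ← coe_intCoord h, hxy]

theorem intCoord_surjective (h : IsTypeB e) : Function.Surjective (intCoord h) := fun v => by
  obtain ⟨x, hx⟩ := coord_surjective e fun k => (v k : ℝ)
  refine ⟨⟨x, h.mem_coweightLattice_iff.2 fun k => ⟨v k, congrFun hx k⟩⟩, funext fun k => ?_⟩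
  rw [← @Int.cast_inj ℝ, coe_intCoord]
  exact congrFun hx k

theorem modCoord_surjective (h : IsTypeB e) (q : ℕ) : Function.Surjective (modCoord h q) :=
  (Function.Surjective.comp_left ZMod.intCast_surjective).comp (intCoord_surjective h)

theorem ker_modCoord (h : IsTypeB e) (q : ℕ) : (modCoord h q).ker = multiples P q := by
  ext x
  rw [AddMonoidHom.mem_ker]
  constructor
  · intro hx
    have dvd_intCoord (k) : ∃ m : ℤ, intCoord h x k = q * m := by
      rw [← dvd_def, ← ZMod.intCast_zmod_eq_zero_iff_dvd, ← modCoord_apply h, hx, Pi.zero_apply]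
    choose m hm using dvd_intCoord
    obtain ⟨y, hy⟩ := intCoord_surjective h m
    refine ⟨y, intCoord_injective h (funext fun k => ?_)⟩
    rw [hm, ← hy, nsmulAddMonoidHom_apply, map_nsmul, Pi.smul_apply, nsmul_eq_mul]
  · rintro ⟨y, rfl⟩
    ext k
    simp

/-- The isomorphism of `Z / qZ` with `(ZMod q) ^ ℓ` given by the coordinates modulo `q`. -/
noncomputable def quotientCoordEquiv (h : IsTypeB e) (q : ℕ) :
    coweightLattice P ⧸ multiples P q ≃+ (Fin (n + 1) → ZMod q) :=
  (QuotientAddGroup.quotientAddEquivOfEq (ker_modCoord h q).symm).trans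
    (QuotientAddGroup.quotientKerEquivOfSurjective _ (modCoord_surjective h q))

theorem quotientCoordEquiv_mk (h : IsTypeB e) (q : ℕ) (x : coweightLattice P) :
    quotientCoordEquiv h q (x : coweightLattice P ⧸ multiples P q) = modCoord h q x := rfl

theorem mem_complement_iff (h : IsTypeB e) (q : ℕ) (z : coweightLattice P ⧸ multiples P q) :
    z ∈ complement P q ↔ IsRegular (quotientCoordEquiv h q z) := by
  constructor
  · rintro ⟨x, rfl, hx⟩
    rwa [quotientCoordEquiv_mk, isRegular_modCoord_iff]
  · obtain ⟨x, rfl⟩ := QuotientAddGroup.mk_surjective z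
    exact fun hz => ⟨x, rfl, (isRegular_modCoord_iff h q x).1 hz⟩

variable [IsEuclidean P]

theorem ActsBy.quotientCoordEquiv_modAction {w : P.weylGroup}
    {σ : Equiv.Perm (Fin (n + 1))} {s : Fin (n + 1) → ℤˣ} (hw : ActsBy e w σ s) (h : IsTypeB e)
    (q : ℕ) (z : coweightLattice P ⧸ multiples P q) (k : Fin (n + 1)) :
    quotientCoordEquiv h q (modAction P q w z) (σ k) = s k • quotientCoordEquiv h q z k := by
  obtain ⟨x, rfl⟩ := QuotientAddGroup.mk_surjective z
  exact hw.modCoord_latticeAction h q x k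

theorem ActsBy.chi_eq_ncard {w : P.weylGroup} {σ : Equiv.Perm (Fin (n + 1))}
    {s : Fin (n + 1) → ℤˣ} (hw : ActsBy e w σ s) (h : IsTypeB e) (q : ℕ) :
    chi P q w =
      {v : Fin (n + 1) → ZMod q | IsRegular v ∧ ∀ k, v (σ k) = s k • v k}.ncard := by
  rw [chi, ← Set.ncard_image_of_injective _ (quotientCoordEquiv h q).injective,
    ← AddEquiv.coe_toEquiv, Equiv.image_eq_preimage_symm]
  congr 1
  ext v
  obtain ⟨z, rfl⟩ := (quotientCoordEquiv h q).surjective v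
  have fixed_iff : modAction P q w z = z ↔
      ∀ k, quotientCoordEquiv h q z (σ k) = s k • quotientCoordEquiv h q z k := by
    rw [← (quotientCoordEquiv h q).injective.eq_iff, funext_iff, σ.surjective.forall]
    exact forall_congr' fun k => by rw [hw.quotientCoordEquiv_modAction h, eq_comm]
  simp [mem_complement_iff h, fixed_iff]

theorem IsTypeB.chi_one (h : IsTypeB e) (q : ℕ) :
    chi P q 1 = Nat.card {v : Fin (n + 1) → ZMod q // IsRegular v} := by
  rw [(actsBy_one (e := e)).chi_eq_ncard h, ← Set.coe_ofPred, Nat.card_coe_set_eq]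
  simp

theorem IsTypeB.chi_omega (h : IsTypeB e) (q : ℕ) :
    chi P q (omega b (e 0)) = {v : Fin (n + 1) → ZMod q | IsRegular v ∧ v 0 = -v 0}.ncard := by
  rw [h.actsBy_omega.chi_eq_ncard h]
  congr! 4 with v
  simp [Fin.forall_fin_succ]

end Reduction

end CoxeterCharacter

theorem mainTheorem6 {ι E N : Type*} [Finite ι] [NormedAddCommGroup E] [InnerProductSpace ℝ E]
    [AddCommGroup N] [Module ℝ N] (P : RootPairing ι ℝ E N)
    [P.IsRootSystem] [P.IsCrystallographic] [P.IsReduced] [CoxeterCharacter.IsEuclidean P]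
    (ℓ : ℕ) (hℓ : 2 ≤ ℓ) (b : P.Base) (e : Fin ℓ ≃ b.support)
    (hB : ∀ i j, b.cartanMatrix (e i) (e j) = CartanMatrix.B ℓ i j) :
    CoxeterCharacter.alcoveStabilizer b = {1, CoxeterCharacter.omega b (e ⟨0, by omega⟩)} ∧
    ∀ q : ℕ, 0 < q →
      (Odd q → (CoxeterCharacter.chi P q 1 : ℤ) =
        ∏ i ∈ Finset.Icc 1 ℓ, ((q : ℤ) - (2 * (i : ℤ) - 1))) ∧
      (Even q → (CoxeterCharacter.chi P q 1 : ℤ) =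
        (∏ i ∈ Finset.Icc 1 (ℓ - 1), ((q : ℤ) - 2 * (i : ℤ))) * ((q : ℤ) - (ℓ : ℤ))) ∧
      (Odd q → (CoxeterCharacter.chi P q (CoxeterCharacter.omega b (e ⟨0, by omega⟩)) : ℤ) = 0) ∧
      (Even q → (CoxeterCharacter.chi P q (CoxeterCharacter.omega b (e ⟨0, by omega⟩)) : ℤ) =
        ∏ i ∈ Finset.Icc 1 (ℓ - 1), ((q : ℤ) - 2 * (i : ℤ))) := by
  obtain ⟨n, rfl⟩ : ∃ n, ℓ = n + 2 := ⟨ℓ - 2, by omega⟩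
  have h : CoxeterCharacter.IsTypeB e := hB
  rw [show (⟨0, by omega⟩ : Fin (n + 2)) = 0 from rfl]
  refine ⟨h.alcoveStabilizer_eq, fun q hq => ?_⟩
  have : NeZero q := ⟨hq.ne'⟩
  rw [h.chi_one, h.chi_omega]
  exact ⟨fun hodd => CoxeterCharacter.card_isRegular_zmod_of_odd hodd _,
    fun heven => CoxeterCharacter.card_isRegular_zmod_of_even heven _,
    fun hodd => congrArg Nat.cast
      (CoxeterCharacter.ncard_isRegular_zmod_self_eq_neg_of_odd hodd 0),
    fun heven => CoxeterCharacter.ncard_isRegular_zmod_self_eq_neg_of_even heven 0⟩
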